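/- Let $n_1,n_2$ be positive odd integers. For $n$ odd, a splitting of $\mathbb{Z}/n\mathbb{Z}$ given by the multiplier $\mu_b\colon x\mapsto bx$ ($b\in\mathbb{Z}$, $\gcd(b,n)=1$) is a triple $(X,S_1,S_2)$ of non-empty, pairwise disjoint unions of $2$-cyclotomic cosets $Z(s)=\{2^js : j\ge 0\}$ with $X\cup S_1\cup S_2=\mathbb{Z}/n\mathbb{Z}$, $\mu_b(S_1)=S_2$, $\mu_b(S_2)=S_1$, and $\mu_b(Z(s))=Z(s)$ for every $s\in X$. Let $T=(T_0,T_1,T_2)$ and $U=(U_0,U_1,U_2)$ be splittings of $\mathbb{Z}/n_1\mathbb{Z}$ and $\mathbb{Z}/n_2\mathbb{Z}$, respectively, with $U_0=\{0\}$, which are either given by the same multiplier $\mu_b$ ($b\in\mathbb{Z}$), or given by possibly different multipliers with $\gcd(n_1,n_2)=1$. Let $S=(S_0,S_1,S_2)$ be the extended splitting $$S_0=\{in_2 : i\in T_0\},\qquad S_k=\{in_2 : i\in T_k\}\cup\{i+jn_2 : i\in U_k,\ 0\le j\le n_1-1\}\quad(k=1,2)$$ in $\mathbb{Z}/n_1n_2\mathbb{Z}$.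 Assume that $n_1/|T_0|\ge n_2$. Let $\alpha$ be a primitive $(n_1n_2)$-th root of unity in an extension field of $\mathbb{F}_2$. Then $S$ is a splitting of $\mathbb{Z}/n_1n_2\mathbb{Z}$, and there are binary cyclic codes $C\subseteq D$ of length $n_1n_2$ with defining sets (with respect to $\alpha$) $S_0\cup S_1$ and $S_1$, respectively. The CSS code of $C\subseteq D$, i.e. the stabilizer code whose stabilizer group $G$ is generated by $\{X^u : u\in C\}\cup\{Z^v : v\in D^\perp\}$, is a binary quantum code with parameters $[\![n_1n_2,|T_0|,d]\!]_2$ for some $d>n_2$: it is a $2^{|T_0|}$-dimensional subspace of $(\mathbb{C}^2)^{\otimes n_1n_2}$, and $d$ is the minimum weight of a Pauli error that it does not detect. It is degenerate, i.e. $d$ is greater than the minimum weight of the non-identity Pauli matrices that commute with every element of $G$. -/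

import Mathlib

open Matrix Polynomial

/-! ### Cyclotomic cosets, multipliers and splittings -/

/-- The `2`-cyclotomic coset `Z(s) = {s, 2s, 4s, …}` modulo `n`. -/
def cyclotomicCoset (n : ℕ) (s : ZMod n) : Set (ZMod n) :=
  {t | ∃ j : ℕ, t = s * 2 ^ j}

/-- `A` is a union of `2`-cyclotomic cosets modulo `n`. -/
def IsUnionOfCosets {n : ℕ} (A : Set (ZMod n)) : Prop :=
  ∀ s ∈ A, cyclotomicCoset n s ⊆ A

/-- The map `μ_b : x ↦ b x` on `ℤ/nℤ`; it is a multiplier when `gcd(n, b) = 1`. -/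
def multiplier (n : ℕ) (b : ℤ) (x : ZMod n) : ZMod n := (b : ZMod n) * x

/-- `(X, S₁, S₂)` is a splitting of `ℤ/nℤ` that is given by the multiplier `μ_b`. -/
structure IsSplitting (n : ℕ) (b : ℤ) (X S₁ S₂ : Set (ZMod n)) : Prop where
  coprime : Int.gcd (n : ℤ) b = 1
  cosets_X : IsUnionOfCosets X
  cosets_one : IsUnionOfCosets S₁
  cosets_two : IsUnionOfCosets S₂
  cover : X ∪ S₁ ∪ S₂ = Set.univ
  nonempty_X : X.Nonempty
  nonempty_one : S₁.Nonempty
  nonempty_two : S₂.Nonempty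
  disjoint_X_one : Disjoint X S₁
  disjoint_X_two : Disjoint X S₂
  disjoint_one_two : Disjoint S₁ S₂
  map_one : multiplier n b '' S₁ = S₂
  map_two : multiplier n b '' S₂ = S₁
  map_X : ∀ s ∈ X, multiplier n b '' cyclotomicCoset n s = cyclotomicCoset n s

/-- The part `{i n₂ : i ∈ A}` of `ℤ/n₁n₂ℤ`, for `A ⊆ ℤ/n₁ℤ`. -/
def scaledPart (n₁ n₂ : ℕ) (A : Set (ZMod n₁)) : Set (ZMod (n₁ * n₂)) :=
  {x | ∃ i ∈ A, x = ((i.val * n₂ : ℕ) : ZMod (n₁ * n₂))}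

/-- The part `{i + j n₂ : i ∈ B, 0 ≤ j ≤ n₁ - 1}` of `ℤ/n₁n₂ℤ`, for `B ⊆ ℤ/n₂ℤ`. -/
def liftedPart (n₁ n₂ : ℕ) (B : Set (ZMod n₂)) : Set (ZMod (n₁ * n₂)) :=
  {x | ∃ i ∈ B, ∃ j : ℕ, j < n₁ ∧ x = ((i.val + j * n₂ : ℕ) : ZMod (n₁ * n₂))}

/-- The component `S₀` of the extended splitting of `T` and `U` (where `U₀ = {0}`). -/
def extendedZero (n₁ n₂ : ℕ) (T₀ : Set (ZMod n₁)) : Set (ZMod (n₁ * n₂)) :=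
  scaledPart n₁ n₂ T₀

/-- The components `S_k`, `k = 1, 2`, of the extended splitting of `T` and `U`. -/
def extendedPart (n₁ n₂ : ℕ) (Tk : Set (ZMod n₁)) (Uk : Set (ZMod n₂)) :
    Set (ZMod (n₁ * n₂)) :=
  scaledPart n₁ n₂ Tk ∪ liftedPart n₁ n₂ Uk

/-! ### Binary linear and cyclic codes -/

/-- A binary linear code of length `n`. -/
abbrev BinaryCode (n : ℕ) := Submodule (ZMod 2) (Fin n → ZMod 2)

/-- The Euclidean dual of a binary linear code. -/
def dualCode {n : ℕ} (C : BinaryCode n) : BinaryCode n where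
  carrier := {u | ∀ c ∈ C, u ⬝ᵥ c = 0}
  zero_mem' := fun c _ => zero_dotProduct c
  add_mem' := fun {u v} hu hv c hc => by
    rw [add_dotProduct, hu c hc, hv c hc, add_zero]
  smul_mem' := fun a u hu c hc => by
    rw [smul_dotProduct, hu c hc, smul_zero]

/-- The cyclic shift `(c₀, …, c_{n-1}) ↦ (c_{n-1}, c₀, …, c_{n-2})`. -/
def cyclicShift {n : ℕ} (c : Fin n → ZMod 2) : Fin n → ZMod 2 :=
  fun i => c ((finRotate n).symm i)

/-- A linear code that is closed under cyclic shifts. -/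
def IsCyclicCode {n : ℕ} (C : BinaryCode n) : Prop :=
  ∀ c ∈ C, cyclicShift c ∈ C

/-- The polynomial `c(x) = ∑ cᵢ xⁱ` of a vector. -/
noncomputable def vecPoly {n : ℕ} (c : Fin n → ZMod 2) : (ZMod 2)[X] :=
  ∑ i : Fin n, C (c i) * X ^ (i : ℕ)

/-- `g` is the generator polynomial of the cyclic code `C`: the monic divisor of `x ^ n - 1`
whose multiples of degree less than `n` are exactly the codewords. -/
def IsGeneratorPoly {n : ℕ} (C : BinaryCode n) (g : (ZMod 2)[X]) : Prop :=
  g.Monic ∧ g ∣ X ^ n - 1 ∧ ∀ c : Fin n → ZMod 2, c ∈ C ↔ g ∣ vecPoly c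

/-- `C` is a binary cyclic code whose defining set `{t : g(α ^ t) = 0}`, with respect to the
primitive `n`-th root of unity `α`, is `A`. -/
def IsCyclicWithDefiningSet {n : ℕ} {F : Type*} [Field F] [Algebra (ZMod 2) F] (α : F)
    (C : BinaryCode n) (A : Set (ZMod n)) : Prop :=
  IsCyclicCode C ∧ ∃ g : (ZMod 2)[X], IsGeneratorPoly C g ∧
    A = {t : ZMod n | aeval (α ^ t.val) g = 0}

/-! ### Pauli matrices, stabilizer codes and the CSS construction -/

/-- Matrices acting on `n` qubits, in the standard basis, which is indexed by `{0,1}ⁿ`. -/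
abbrev QubitMatrix (n : ℕ) := Matrix (Fin n → Fin 2) (Fin n → Fin 2) ℂ

/-- The Pauli matrix `X`. -/
def sigmaX : Matrix (Fin 2) (Fin 2) ℂ := !![0, 1; 1, 0]

/-- The Pauli matrix `Z`. -/
def sigmaZ : Matrix (Fin 2) (Fin 2) ℂ := !![1, 0; 0, -1]

/-- The `n`-qubit Pauli matrix `X^u Z^v = X^{u₁} Z^{v₁} ⊗ ⋯ ⊗ X^{uₙ} Z^{vₙ}`. -/
noncomputable def pauli {n : ℕ} (u v : Fin n → ZMod 2) : QubitMatrix n :=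
  fun x y => ∏ i, (sigmaX ^ (u i).val * sigmaZ ^ (v i).val) (x i) (y i)

/-- The weight of `X^u Z^v`: the number of its non-identity tensor components. -/
def pauliWeight {n : ℕ} (u v : Fin n → ZMod 2) : ℕ :=
  (Finset.univ.filter fun i => u i ≠ 0 ∨ v i ≠ 0).card

/-- The `n`-qubit Pauli group, generated by the matrices `i^k X^u Z^v`. -/
def pauliGroup (n : ℕ) : Subgroup (QubitMatrix n)ˣ :=
  Subgroup.closure
    {g | ∃ (k : ℕ) (u v : Fin n → ZMod 2), (g : QubitMatrix n) = Complex.I ^ k • pauli u v}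

/-- A commutative subgroup of the Pauli group that contains no multiple of the identity
other than the identity itself. -/
def IsStabilizerGroup {n : ℕ} (G : Subgroup (QubitMatrix n)ˣ) : Prop :=
  G ≤ pauliGroup n ∧ (∀ g ∈ G, ∀ h ∈ G, g * h = h * g) ∧
    ∀ g ∈ G, ∀ a : ℂ, (g : QubitMatrix n) = a • (1 : QubitMatrix n) → g = 1

/-- The common eigenspace with eigenvalue `+1` of `G`. -/
def stabilizerCode {n : ℕ} (G : Subgroup (QubitMatrix n)ˣ) :
    Submodule ℂ ((Fin n → Fin 2) → ℂ) where
  carrier := {ψ | ∀ g ∈ G, (g : QubitMatrix n) *ᵥ ψ = ψ}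
  zero_mem' := fun g _ => mulVec_zero (g : QubitMatrix n)
  add_mem' := fun {ψ φ} hψ hφ g hg => by
    rw [mulVec_add, hψ g hg, hφ g hg]
  smul_mem' := fun a ψ hψ g hg => by
    rw [mulVec_smul, hψ g hg]

/-- The error `X^u Z^v` is detectable by the quantum code `Q`: there is a scalar `a` with
`⟨ψ, X^u Z^v φ⟩ = a ⟨ψ, φ⟩` for all `ψ, φ ∈ Q` (that is, `P E P = a P` for the orthogonal
projection `P` onto `Q`). -/
def IsDetectable {n : ℕ} (Q : Submodule ℂ ((Fin n → Fin 2) → ℂ)) (u v : Fin n → ZMod 2) :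
    Prop :=
  ∃ a : ℂ, ∀ ψ ∈ Q, ∀ φ ∈ Q, star ψ ⬝ᵥ (pauli u v *ᵥ φ) = a * (star ψ ⬝ᵥ φ)

/-- `d` is the minimum distance of the quantum code `Q` (of dimension at least two): the
smallest weight of a Pauli error that `Q` does not detect. -/
def HasMinDistance {n : ℕ} (Q : Submodule ℂ ((Fin n → Fin 2) → ℂ)) (d : ℕ) : Prop :=
  IsLeast {w | ∃ u v : Fin n → ZMod 2, ¬ IsDetectable Q u v ∧ pauliWeight u v = w} d

/-- `Q` is a binary quantum code with parameters `[[n, k, d]]`, for `k ≥ 1`. -/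
def IsQuantumCode (n k d : ℕ) (Q : Submodule ℂ ((Fin n → Fin 2) → ℂ)) : Prop :=
  Module.finrank ℂ Q = 2 ^ k ∧ HasMinDistance Q d

/-- `X^u Z^v` lies in the Pauli normalizer `N(G)`: it commutes with each element of `G`. -/
def InPauliNormalizer {n : ℕ} (G : Subgroup (QubitMatrix n)ˣ) (u v : Fin n → ZMod 2) : Prop :=
  ∀ g ∈ G, pauli u v * (g : QubitMatrix n) = (g : QubitMatrix n) * pauli u v

/-- The stabilizer code of `G` is degenerate: its minimum distance is greater than the minimum
weight of the non-identity error operators in `N(G)`. -/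
def IsDegenerate {n : ℕ} (G : Subgroup (QubitMatrix n)ˣ) : Prop :=
  ∃ d, HasMinDistance (stabilizerCode G) d ∧
    ∃ u v : Fin n → ZMod 2, (u ≠ 0 ∨ v ≠ 0) ∧ InPauliNormalizer G u v ∧ pauliWeight u v < d

/-- The stabilizer group of the CSS code of `C₂ ⊆ C₁`, generated by
`{X^u : u ∈ C₂} ∪ {Z^v : v ∈ C₁^⊥}`. -/
def cssGroup {n : ℕ} (C₂ C₁ : BinaryCode n) : Subgroup (QubitMatrix n)ˣ :=
  Subgroup.closure
    {g | (∃ u ∈ C₂, (g : QubitMatrix n) = pauli u 0) ∨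
      ∃ v ∈ dualCode C₁, (g : QubitMatrix n) = pauli 0 v}

/-! Scaling by `n₂` and reduction modulo `n₂` form an exact sequence `ℤ/n₁ → ℤ/n₁n₂ → ℤ/n₂`. The
scaled parts are images, the lifted parts are preimages, and the splitting axioms follow from those
of `T` and `U` once both use one multiplier `b`.

Let `C ⊆ D` be the codes whose Fourier coefficients vanish on `S₀ ∪ S₁` and on `S₁`. Their
dimensions are `N - |S₀ ∪ S₁|` and `N - |S₁|`, where `N = n₁n₂`, and the code space is the space of
functions on `D / C`, hence of dimension `2 ^ |T₀|`. An undetectable error has its `X` part in `D \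
C` or its `Z` part in `C^⊥ \ D^⊥`, so `d > n₂` is a bound on the weights of these words.

That bound is `IsSplitting.lt_card`. For `c ∈ D \ C` with support `A`, the product `c(x) c(x^b)` has
spectrum inside `S₀` and is not zero, so by a Vandermonde argument any `|S₀|` consecutive
coefficients include a nonzero one. Hence `N ≤ |S₀| |A|²`, and `|A| ≥ n₂`. If `|A| = n₂`, every
estimate is sharp: the support of the product is a coset of a subgroup `H` of order `n₂²`, and each
of its elements is uniquely of the form `a + b a'` with `a, a' ∈ A`. In such a factorization the
second factor may be multiplied by any positive integer prime to its size
(`injOn_add_nsmul_of_coprime`); multiplying by an inverse of `b` makes the sums `a + a'` unique,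
which commutativity forbids.

Degeneracy comes from a low weight word of `C` itself: a nonzero `e(x)` in the code of length `n₂`
with zeros `{0} ∪ U₁` yields `e(x ^ n₁)`, of weight at most `n₂ < d`. -/

/-! ### The extended splitting -/

/-- The embedding `i ↦ i n₂` of `ℤ/n₁ℤ` into `ℤ/n₁n₂ℤ`. -/
def scaleHom (n₁ n₂ : ℕ) : ZMod n₁ →+ ZMod (n₁ * n₂) :=
  ZMod.lift n₁ ⟨(AddMonoidHom.mulRight (n₂ : ZMod (n₁ * n₂))).comp
    (Int.castAddHom (ZMod (n₁ * n₂))), by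
      simp only [AddMonoidHom.coe_comp, Function.comp_apply, Int.coe_castAddHom,
        AddMonoidHom.coe_mulRight, Int.cast_natCast]
      rw [← Nat.cast_mul, ZMod.natCast_self]⟩

theorem scaleHom_intCast (n₁ n₂ : ℕ) (k : ℤ) :
    scaleHom n₁ n₂ (k : ZMod n₁) = k * (n₂ : ZMod (n₁ * n₂)) := by
  simp [scaleHom]

theorem scaleHom_natCast (n₁ n₂ k : ℕ) :
    scaleHom n₁ n₂ (k : ZMod n₁) = k * (n₂ : ZMod (n₁ * n₂)) := by
  simpa using scaleHom_intCast n₁ n₂ k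

theorem scaleHom_intCast_mul (n₁ n₂ : ℕ) (b : ℤ) (i : ZMod n₁) :
    scaleHom n₁ n₂ (b * i) = b * scaleHom n₁ n₂ i := by
  rw [← zsmul_eq_mul, map_zsmul, zsmul_eq_mul]

theorem scaleHom_mul_two_pow (n₁ n₂ : ℕ) (i : ZMod n₁) (j : ℕ) :
    scaleHom n₁ n₂ (i * 2 ^ j) = scaleHom n₁ n₂ i * 2 ^ j := by
  have := scaleHom_intCast_mul n₁ n₂ (2 ^ j) i
  push_cast at this
  rw [mul_comm i, this, mul_comm (2 ^ j)]

theorem scaleHom_injective (n₁ n₂ : ℕ) [NeZero n₂] : Function.Injective (scaleHom n₁ n₂) := by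
  rw [injective_iff_map_eq_zero]
  intro i hi
  obtain ⟨k, rfl⟩ := ZMod.intCast_surjective i
  rw [scaleHom_intCast] at hi
  have h : (((k * n₂ : ℤ)) : ZMod (n₁ * n₂)) = 0 := by push_cast; exact hi
  rw [ZMod.intCast_zmod_eq_zero_iff_dvd] at h
  rw [ZMod.intCast_zmod_eq_zero_iff_dvd]
  push_cast at h
  exact Int.dvd_of_mul_dvd_mul_right (by exact_mod_cast NeZero.ne n₂) h

theorem scaledPart_eq_image (n₁ n₂ : ℕ) [NeZero n₁] (A : Set (ZMod n₁)) :
    scaledPart n₁ n₂ A = scaleHom n₁ n₂ '' A := by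
  have h : ∀ i : ZMod n₁, ((i.val * n₂ : ℕ) : ZMod (n₁ * n₂)) = scaleHom n₁ n₂ i := by
    intro i
    conv_rhs => rw [← ZMod.natCast_zmod_val i]
    rw [scaleHom_natCast, Nat.cast_mul]
  ext x
  simp only [scaledPart, h, Set.mem_ofPred_eq, Set.mem_image, eq_comm]

/-- The reduction of `ℤ/n₁n₂ℤ` modulo `n₂`. -/
def reduceHom (n₁ n₂ : ℕ) : ZMod (n₁ * n₂) →+* ZMod n₂ :=
  ZMod.castHom (dvd_mul_left n₂ n₁) (ZMod n₂)

theorem liftedPart_eq_preimage (n₁ n₂ : ℕ) [NeZero n₁] [NeZero n₂] (B : Set (ZMod n₂)) :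
    liftedPart n₁ n₂ B = reduceHom n₁ n₂ ⁻¹' B := by
  have : NeZero (n₁ * n₂) := ⟨mul_ne_zero (NeZero.ne _) (NeZero.ne _)⟩
  ext x
  constructor
  · rintro ⟨i, hi, j, -, rfl⟩
    rw [Set.mem_preimage, map_natCast]
    simpa using hi
  · intro hx
    refine ⟨_, hx, x.val / n₂, Nat.div_lt_of_lt_mul (mul_comm n₁ n₂ ▸ ZMod.val_lt x), ?_⟩
    have h : (reduceHom n₁ n₂ x).val = x.val % n₂ := by
      conv_lhs => rw [← ZMod.natCast_zmod_val x]
      rw [map_natCast, ZMod.val_natCast]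
    rw [h, Nat.mod_add_div', ZMod.natCast_zmod_val]

theorem reduceHom_scaleHom (n₁ n₂ : ℕ) (i : ZMod n₁) :
    reduceHom n₁ n₂ (scaleHom n₁ n₂ i) = 0 := by
  obtain ⟨k, rfl⟩ := ZMod.intCast_surjective i
  simp [scaleHom_intCast]

/-- Exactness in the middle: a residue divisible by `n₂` comes from `ℤ/n₁`. This reduces the
covering property of the extension to those of `U` and then `T`. -/
theorem exists_scaleHom_eq {n₁ n₂ : ℕ} [NeZero n₁] [NeZero n₂] {x : ZMod (n₁ * n₂)}
    (hx : reduceHom n₁ n₂ x = 0) : ∃ i, scaleHom n₁ n₂ i = x := by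
  obtain ⟨k, rfl⟩ := ZMod.intCast_surjective x
  rw [map_intCast, ZMod.intCast_zmod_eq_zero_iff_dvd] at hx
  obtain ⟨l, rfl⟩ := hx
  exact ⟨l, by rw [scaleHom_intCast]; push_cast; ring⟩

theorem exists_intCast_mul_eq {n : ℕ} {b : ℤ} (hb : Int.gcd (n : ℤ) b = 1) (x : ZMod n) :
    ∃ c : ZMod n, (b : ZMod n) * c = x ∧ ∀ z, (b : ZMod n) * z = x → z = c := by
  obtain ⟨u, v, huv⟩ := Int.isCoprime_iff_gcd_eq_one.2 hb
  have h : (v : ZMod n) * b = 1 := by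
    have := congrArg (Int.cast : ℤ → ZMod n) huv
    simpa using this
  refine ⟨v * x, by rw [← mul_assoc, mul_comm (b : ZMod n), h, one_mul], fun z hz => ?_⟩
  rw [← hz, ← mul_assoc, h, one_mul]

theorem image_multiplier_cyclotomicCoset (n : ℕ) (b : ℤ) (s : ZMod n) :
    multiplier n b '' cyclotomicCoset n s = cyclotomicCoset n (b * s) := by
  ext x
  simp only [multiplier, cyclotomicCoset, Set.mem_image, Set.mem_ofPred_eq]
  constructor
  · rintro ⟨_, ⟨j, rfl⟩, rfl⟩
    exact ⟨j, by ring⟩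
  · rintro ⟨j, rfl⟩
    exact ⟨_, ⟨j, rfl⟩, by ring⟩

theorem IsSplitting.congr_multiplier {n : ℕ} {a b : ℤ} {X S₁ S₂ : Set (ZMod n)}
    (h : IsSplitting n a X S₁ S₂) (hab : (a : ZMod n) = b) : IsSplitting n b X S₁ S₂ := by
  have hm : multiplier n a = multiplier n b := by
    funext x
    simp only [multiplier, hab]
  refine { h with
    coprime := ?_
    map_one := hm ▸ h.map_one
    map_two := hm ▸ h.map_two
    map_X := hm ▸ h.map_X }
  have h1 := h.coprime
  rw [ZMod.intCast_eq_intCast_iff_dvd_sub] at hab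
  obtain ⟨k, hk⟩ := hab
  rw [← Int.isCoprime_iff_gcd_eq_one] at h1 ⊢
  rw [show b = a + n * k by linear_combination hk]
  exact h1.add_mul_left_right k

theorem IsSplitting.symm {n : ℕ} {b : ℤ} {X S₁ S₂ : Set (ZMod n)}
    (h : IsSplitting n b X S₁ S₂) : IsSplitting n b X S₂ S₁ where
  coprime := h.coprime
  cosets_X := h.cosets_X
  cosets_one := h.cosets_two
  cosets_two := h.cosets_one
  cover := by rw [← h.cover, Set.union_assoc, Set.union_assoc, Set.union_comm S₂]
  nonempty_X := h.nonempty_X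
  nonempty_one := h.nonempty_two
  nonempty_two := h.nonempty_one
  disjoint_X_one := h.disjoint_X_two
  disjoint_X_two := h.disjoint_X_one
  disjoint_one_two := h.disjoint_one_two.symm
  map_one := h.map_two
  map_two := h.map_one
  map_X := h.map_X

theorem mem_extendedZero {n₁ n₂ : ℕ} [NeZero n₁] {T : Set (ZMod n₁)}
    {x : ZMod (n₁ * n₂)} :
    x ∈ extendedZero n₁ n₂ T ↔ ∃ i ∈ T, scaleHom n₁ n₂ i = x := by
  rw [extendedZero, scaledPart_eq_image, Set.mem_image]

theorem isUnionOfCosets_extendedZero {n₁ n₂ : ℕ} [NeZero n₁] {T : Set (ZMod n₁)}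
    (hT : IsUnionOfCosets T) :
    IsUnionOfCosets (extendedZero n₁ n₂ T) := by
  rintro s hs _ ⟨j, rfl⟩
  rw [mem_extendedZero] at hs ⊢
  obtain ⟨i, hi, rfl⟩ := hs
  exact ⟨i * 2 ^ j, hT i hi ⟨j, rfl⟩, scaleHom_mul_two_pow _ _ _ _⟩

section Extended

variable {n₁ n₂ : ℕ} [NeZero n₁] [NeZero n₂]

theorem mem_extendedPart {T : Set (ZMod n₁)} {U : Set (ZMod n₂)} {x : ZMod (n₁ * n₂)} :
    x ∈ extendedPart n₁ n₂ T U ↔ (∃ i ∈ T, scaleHom n₁ n₂ i = x) ∨ reduceHom n₁ n₂ x ∈ U := by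
  rw [extendedPart, scaledPart_eq_image, liftedPart_eq_preimage]
  rfl

theorem isUnionOfCosets_extendedPart {T : Set (ZMod n₁)} {U : Set (ZMod n₂)}
    (hT : IsUnionOfCosets T) (hU : IsUnionOfCosets U) :
    IsUnionOfCosets (extendedPart n₁ n₂ T U) := by
  rintro s hs _ ⟨j, rfl⟩
  rw [mem_extendedPart] at hs ⊢
  rcases hs with ⟨i, hi, rfl⟩ | hs
  · exact Or.inl ⟨i * 2 ^ j, hT i hi ⟨j, rfl⟩, scaleHom_mul_two_pow _ _ _ _⟩
  · refine Or.inr ?_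
    rw [map_mul, map_pow, map_ofNat]
    exact hU _ hs ⟨j, rfl⟩

theorem disjoint_extendedZero_extendedPart {T T' : Set (ZMod n₁)} {U : Set (ZMod n₂)}
    (hT : Disjoint T T') (hU : (0 : ZMod n₂) ∉ U) :
    Disjoint (extendedZero n₁ n₂ T) (extendedPart n₁ n₂ T' U) := by
  rw [Set.disjoint_left]
  intro x hx hx'
  rw [mem_extendedZero] at hx
  rw [mem_extendedPart] at hx'
  obtain ⟨i, hi, rfl⟩ := hx
  rcases hx' with ⟨i', hi', h⟩ | h
  · exact Set.disjoint_left.1 hT hi (scaleHom_injective _ _ h ▸ hi')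
  · rw [reduceHom_scaleHom] at h
    exact hU h

theorem disjoint_extendedPart {T T' : Set (ZMod n₁)} {U U' : Set (ZMod n₂)}
    (hT : Disjoint T T') (hU : Disjoint U U') (h0 : (0 : ZMod n₂) ∉ U)
    (h0' : (0 : ZMod n₂) ∉ U') :
    Disjoint (extendedPart n₁ n₂ T U) (extendedPart n₁ n₂ T' U') := by
  rw [Set.disjoint_left]
  intro x hx hx'
  rw [mem_extendedPart] at hx hx'
  rcases hx with ⟨i, hi, rfl⟩ | h
  · rcases hx' with ⟨i', hi', h⟩ | h
    · exact Set.disjoint_left.1 hT hi (scaleHom_injective _ _ h ▸ hi')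
    · rw [reduceHom_scaleHom] at h
      exact h0' h
  · rcases hx' with ⟨i', hi', rfl⟩ | h'
    · rw [reduceHom_scaleHom] at h
      exact h0 h
    · exact Set.disjoint_left.1 hU h h'

theorem image_multiplier_extendedPart {b : ℤ} {T T' : Set (ZMod n₁)} {U U' : Set (ZMod n₂)}
    (hb : Int.gcd ((n₁ * n₂ : ℕ) : ℤ) b = 1) (hT : multiplier n₁ b '' T = T')
    (hbU : Int.gcd (n₂ : ℤ) b = 1)
    (hU : multiplier n₂ b '' U = U') :
    multiplier (n₁ * n₂) b '' extendedPart n₁ n₂ T U = extendedPart n₁ n₂ T' U' := by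
  ext x
  rw [mem_extendedPart, Set.mem_image]
  constructor
  · rintro ⟨y, hy, rfl⟩
    rw [mem_extendedPart] at hy
    rcases hy with ⟨i, hi, rfl⟩ | hy
    · exact Or.inl ⟨b * i, hT ▸ ⟨i, hi, rfl⟩, scaleHom_intCast_mul _ _ _ _⟩
    · refine Or.inr ?_
      rw [multiplier, map_mul, map_intCast, ← hU]
      exact ⟨_, hy, rfl⟩
  · rintro (⟨i, hi, rfl⟩ | hx)
    · rw [← hT] at hi
      obtain ⟨i', hi', rfl⟩ := hi
      exact ⟨scaleHom n₁ n₂ i', mem_extendedPart.2 (Or.inl ⟨i', hi', rfl⟩),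
        (scaleHom_intCast_mul _ _ _ _).symm⟩
    · obtain ⟨y, hy, -⟩ := exists_intCast_mul_eq hb x
      refine ⟨y, mem_extendedPart.2 (Or.inr ?_), hy⟩
      rw [← hy, map_mul, map_intCast, ← hU] at hx
      obtain ⟨u, hu, h⟩ := hx
      obtain ⟨c, -, hc⟩ := exists_intCast_mul_eq hbU ((b : ZMod n₂) * reduceHom n₁ n₂ y)
      rwa [hc _ rfl, ← hc u h]

theorem IsSplitting.extended {b : ℤ} {T₀ T₁ T₂ : Set (ZMod n₁)} {U₁ U₂ : Set (ZMod n₂)}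
    (hT : IsSplitting n₁ b T₀ T₁ T₂) (hU : IsSplitting n₂ b {0} U₁ U₂) :
    IsSplitting (n₁ * n₂) b (extendedZero n₁ n₂ T₀) (extendedPart n₁ n₂ T₁ U₁)
      (extendedPart n₁ n₂ T₂ U₂) := by
  have h1 : (0 : ZMod n₂) ∉ U₁ := Set.disjoint_left.1 hU.disjoint_X_one rfl
  have h2 : (0 : ZMod n₂) ∉ U₂ := Set.disjoint_left.1 hU.disjoint_X_two rfl
  have hb : Int.gcd ((n₁ * n₂ : ℕ) : ℤ) b = 1 := by
    rw [← Int.isCoprime_iff_gcd_eq_one]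
    push_cast
    exact IsCoprime.mul_left (Int.isCoprime_iff_gcd_eq_one.2 hT.coprime)
      (Int.isCoprime_iff_gcd_eq_one.2 hU.coprime)
  refine ⟨hb, isUnionOfCosets_extendedZero hT.cosets_X,
    isUnionOfCosets_extendedPart hT.cosets_one hU.cosets_one,
    isUnionOfCosets_extendedPart hT.cosets_two hU.cosets_two, ?_, ?_, ?_, ?_,
    disjoint_extendedZero_extendedPart hT.disjoint_X_one h1,
    disjoint_extendedZero_extendedPart hT.disjoint_X_two h2,
    disjoint_extendedPart hT.disjoint_one_two hU.disjoint_one_two h1 h2,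
    image_multiplier_extendedPart hb hT.map_one hU.coprime hU.map_one,
    image_multiplier_extendedPart hb hT.map_two hU.coprime hU.map_two, ?_⟩
  · refine Set.eq_univ_of_forall fun x => ?_
    simp only [Set.mem_union, mem_extendedZero, mem_extendedPart]
    have hx : reduceHom n₁ n₂ x ∈ {0} ∪ U₁ ∪ U₂ := by rw [hU.cover]; trivial
    rcases hx with (hx | hx) | hx
    · obtain ⟨i, rfl⟩ := exists_scaleHom_eq hx
      have hi : i ∈ T₀ ∪ T₁ ∪ T₂ := by rw [hT.cover]; trivial
      rcases hi with (hi | hi) | hi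
      · exact Or.inl (Or.inl ⟨i, hi, rfl⟩)
      · exact Or.inl (Or.inr (Or.inl ⟨i, hi, rfl⟩))
      · exact Or.inr (Or.inl ⟨i, hi, rfl⟩)
    · exact Or.inl (Or.inr (Or.inr hx))
    · exact Or.inr (Or.inr hx)
  · obtain ⟨i, hi⟩ := hT.nonempty_X
    exact ⟨_, mem_extendedZero.2 ⟨i, hi, rfl⟩⟩
  · obtain ⟨i, hi⟩ := hT.nonempty_one
    exact ⟨_, mem_extendedPart.2 (Or.inl ⟨i, hi, rfl⟩)⟩
  · obtain ⟨i, hi⟩ := hT.nonempty_two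
    exact ⟨_, mem_extendedPart.2 (Or.inl ⟨i, hi, rfl⟩)⟩
  · intro s hs
    rw [mem_extendedZero] at hs
    obtain ⟨i, hi, rfl⟩ := hs
    have h := hT.map_X i hi
    -- Scaling commutes with multiplication by `2` and by `b`, so invariance of cosets under the
    -- multiplier transfers from `ℤ/n₁`.
    have hcoset : ∀ i, cyclotomicCoset (n₁ * n₂) (scaleHom n₁ n₂ i) =
        scaleHom n₁ n₂ '' cyclotomicCoset n₁ i := fun i => by
      ext x
      simp only [cyclotomicCoset, Set.mem_image, Set.mem_ofPred_eq]
      constructor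
      · rintro ⟨j, rfl⟩
        exact ⟨_, ⟨j, rfl⟩, scaleHom_mul_two_pow _ _ _ _⟩
      · rintro ⟨_, ⟨j, rfl⟩, rfl⟩
        exact ⟨j, scaleHom_mul_two_pow _ _ _ _⟩
    rw [image_multiplier_cyclotomicCoset] at h ⊢
    rw [← scaleHom_intCast_mul, hcoset, hcoset, h]

theorem ncard_extendedZero (T : Set (ZMod n₁)) : (extendedZero n₁ n₂ T).ncard = T.ncard := by
  rw [extendedZero, scaledPart_eq_image]
  exact Set.ncard_image_of_injective T (scaleHom_injective n₁ n₂)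

end Extended

/-- A multiplier matters only modulo the length, so the Chinese remainder theorem merges `a` and `b`
into one integer. -/
theorem IsSplitting.exists_common_multiplier {n₁ n₂ : ℕ} {a b : ℤ} {T₀ T₁ T₂ : Set (ZMod n₁)}
    {U₀ U₁ U₂ : Set (ZMod n₂)} (hT : IsSplitting n₁ a T₀ T₁ T₂) (hU : IsSplitting n₂ b U₀ U₁ U₂)
    (h : Nat.gcd n₁ n₂ = 1) :
    ∃ c : ℤ, IsSplitting n₁ c T₀ T₁ T₂ ∧ IsSplitting n₂ c U₀ U₁ U₂ := by
  obtain ⟨u, v, huv⟩ := Nat.isCoprime_iff_coprime.2 h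
  refine ⟨a * (v * n₂) + b * (u * n₁), hT.congr_multiplier ?_, hU.congr_multiplier ?_⟩
  · have := congrArg (Int.cast : ℤ → ZMod n₁) huv
    push_cast at this ⊢
    simp only [ZMod.natCast_self, mul_zero, zero_add, add_zero] at this ⊢
    rw [this, mul_one]
  · have := congrArg (Int.cast : ℤ → ZMod n₂) huv
    push_cast at this ⊢
    simp only [ZMod.natCast_self, mul_zero, zero_add, add_zero] at this ⊢
    rw [this, mul_one]

/-! ### Replacing a factor of a direct sum decomposition by a multiple -/

/-- Write `A`, `B`, `G` also for the sums of their elements in the group ring over `𝔽_p`, with `B`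
already multiplied by `l`. Then `A B = G`, and Frobenius turns `B ^ p` into the sum over the
`p`-fold multiples of `B`. So `A B ^ p = G B ^ (p - 1) = |B| ^ (p - 1) G = G`, by Fermat. -/
theorem injOn_add_nsmul_mul_prime {G : Type*} [AddCommGroup G] [Fintype G] [DecidableEq G]
    {A B : Finset G} (hcard : A.card * B.card = Fintype.card G) {l p : ℕ} (hp : p.Prime)
    (hpB : ¬ p ∣ B.card)
    (hinj : Set.InjOn (fun x : G × G => x.1 + l • x.2) (A ×ˢ B : Finset (G × G))) :
    Set.InjOn (fun x : G × G => x.1 + (l * p) • x.2) (A ×ˢ B : Finset (G × G)) := by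
  have : Fact p.Prime := ⟨hp⟩
  have : CharP (AddMonoidAlgebra (ZMod p) G) p :=
    charP_of_injective_algebraMap (algebraMap (ZMod p) (AddMonoidAlgebra (ZMod p) G)).injective p
  let s : G → AddMonoidAlgebra (ZMod p) G := fun g => AddMonoidAlgebra.single g 1
  have hs : ∀ g h, s g * s h = s (g + h) := fun g h => by
    simp [s, AddMonoidAlgebra.single_mul_single]
  have hprod : ∀ k : ℕ, (∑ x ∈ A, s x) * (∑ b ∈ B, s (k • b)) =
      ∑ x ∈ A ×ˢ B, s (x.1 + k • x.2) := fun k => by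
    rw [Finset.sum_mul_sum, Finset.sum_product]
    simp only [hs]
  have himage : (A ×ˢ B).image (fun x : G × G => x.1 + l • x.2) = Finset.univ := by
    apply Finset.eq_univ_of_card
    rw [Finset.card_image_of_injOn hinj, Finset.card_product, hcard]
  have hE : (∑ x ∈ A, s x) * (∑ b ∈ B, s (l • b)) = ∑ g, s g := by
    rw [hprod, ← himage, Finset.sum_image hinj]
  have hEB : (∑ g, s g) * (∑ b ∈ B, s (l • b)) =
      (B.card : AddMonoidAlgebra (ZMod p) G) * ∑ g, s g := by
    rw [Finset.mul_sum, ← nsmul_eq_mul, ← Finset.sum_const]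
    refine Finset.sum_congr rfl fun b _ => ?_
    rw [Finset.sum_mul]
    simp only [hs]
    exact Fintype.sum_equiv (Equiv.addRight (l • b)) _ _ fun _ => rfl
  have hEBpow : ∀ j : ℕ, (∑ g, s g) * (∑ b ∈ B, s (l • b)) ^ j =
      (B.card : AddMonoidAlgebra (ZMod p) G) ^ j * ∑ g, s g := fun j => by
    induction j with
    | zero => simp
    | succ j ih => rw [pow_succ, ← mul_assoc, ih, mul_assoc, hEB, ← mul_assoc, ← pow_succ]
  have hfermat : (B.card : AddMonoidAlgebra (ZMod p) G) ^ (p - 1) = 1 := by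
    have h : (B.card : ZMod p) ^ (p - 1) = 1 :=
      ZMod.pow_card_sub_one_eq_one (by rwa [Ne, ZMod.natCast_eq_zero_iff])
    have := congrArg (algebraMap (ZMod p) (AddMonoidAlgebra (ZMod p) G)) h
    rwa [map_pow, map_natCast, map_one] at this
  have hfrob : (∑ b ∈ B, s (l • b)) ^ p = ∑ b ∈ B, s ((l * p) • b) := by
    rw [sum_pow_char p]
    refine Finset.sum_congr rfl fun b _ => ?_
    simp only [s, AddMonoidAlgebra.single_pow, one_pow, smul_smul, mul_comm]
  have hmain : ∑ x ∈ A ×ˢ B, s (x.1 + (l * p) • x.2) = ∑ g, s g := by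
    rw [← hprod, ← hfrob, ← mul_pow_sub_one hp.ne_zero, ← mul_assoc, hE, hEBpow, hfermat, one_mul]
  -- Every coefficient of the sum over `G` is `1 ≠ 0` in `𝔽_p`, so every `g` is hit; equal
  -- cardinalities then turn surjectivity into injectivity.
  have hsurj : (A ×ˢ B).image (fun x : G × G => x.1 + (l * p) • x.2) = Finset.univ := by
    refine Finset.eq_univ_of_forall fun g => ?_
    by_contra hg
    have h := congrArg (fun f : AddMonoidAlgebra (ZMod p) G => f.coeff g) hmain
    have hl : (∑ x ∈ A ×ˢ B, s (x.1 + (l * p) • x.2)).coeff g = 0 := by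
      rw [AddMonoidAlgebra.coeff_sum, Finsupp.finsetSum_apply]
      refine Finset.sum_eq_zero fun x hx => Finsupp.single_eq_of_ne fun hxg => hg ?_
      exact Finset.mem_image.2 ⟨x, hx, hxg.symm⟩
    have hr : (∑ g, s g).coeff g = 1 := by
      rw [AddMonoidAlgebra.coeff_sum, Finsupp.finsetSum_apply, Finset.sum_eq_single g]
      · exact Finsupp.single_eq_same
      · exact fun b _ hb => Finsupp.single_eq_of_ne hb.symm
      · simp
    simp only [hl, hr] at h
    exact zero_ne_one h
  apply Finset.card_image_iff.1
  rw [hsurj, Finset.card_product, hcard, Finset.card_univ]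

/-- Multiply by the prime factors of `k` one at a time; `l` carries the product of those already
used, hence is generalized in the induction. -/
theorem injOn_add_nsmul_of_coprime {G : Type*} [AddCommGroup G] [Fintype G] [DecidableEq G]
    {A B : Finset G} (hcard : A.card * B.card = Fintype.card G) (k : ℕ) :
    ∀ l : ℕ, k ≠ 0 → k.Coprime B.card →
      Set.InjOn (fun x : G × G => x.1 + l • x.2) (A ×ˢ B : Finset (G × G)) →
      Set.InjOn (fun x : G × G => x.1 + (l * k) • x.2) (A ×ˢ B : Finset (G × G)) := by
  induction k using Nat.recOnMul with
  | zero => exact fun _ h => absurd rfl h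
  | one => exact fun l _ _ h => by simpa using h
  | prime p hp =>
    exact fun l _ hc h => injOn_add_nsmul_mul_prime hcard hp ((hp.coprime_iff_not_dvd).1 hc) h
  | mul a b ha hb =>
    intro l hab hc h
    rw [← mul_assoc]
    exact hb _ (right_ne_zero_of_mul hab) (hc.coprime_dvd_left (dvd_mul_left b a))
      (ha l (left_ne_zero_of_mul hab) (hc.coprime_dvd_left (dvd_mul_right a b)) h)

/-- A subset with at least two elements is not a direct factor of a finite abelian group whose
complement is a multiple of the same subset, up to translation. -/
theorem not_injOn_add_zsmul {G : Type*} [AddCommGroup G] [DecidableEq G] (H : AddSubgroup G)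
    [Finite H] {A : Finset G} (hcard : A.card * A.card = Nat.card H) (hA : 1 < A.card)
    (hAH : ∀ x ∈ A, ∀ y ∈ A, x - y ∈ H) {b : ℤ} (hb : IsCoprime b (Nat.card H : ℤ))
    (hinj : Set.InjOn (fun x : G × G => x.1 + b • x.2) (A ×ˢ A : Finset (G × G))) : False := by
  classical
  have := Fintype.ofFinite H
  obtain ⟨a₀, ha₀, a₁, ha₁, hne⟩ := Finset.one_lt_card.1 hA
  have hpos : 0 < Nat.card H := Nat.card_pos
  obtain ⟨k, hk0, hkc, hk⟩ : ∃ k : ℕ, k ≠ 0 ∧ k.Coprime A.card ∧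
      ∀ h : H, (k : ℤ) • (b • h) = h := by
    obtain ⟨u, v, huv⟩ := hb
    -- The Bézout coefficient `u` may fail to be positive; adding this multiple of `|H|` makes it so
    -- and keeps its class, hence `k b ≡ 1` modulo `|H|`.
    obtain ⟨k, hk⟩ : ∃ k : ℕ, (k : ℤ) = u + Nat.card H * (1 + |u|) := by
      refine ⟨(u + Nat.card H * (1 + |u|)).toNat, Int.toNat_of_nonneg ?_⟩
      have h1 : (1 : ℤ) ≤ Nat.card H := by exact_mod_cast hpos
      nlinarith [abs_nonneg u, neg_abs_le u]
    have hkb : (k : ℤ) * b + (v - (1 + |u|) * b) * Nat.card H = 1 := by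
      rw [hk]; linear_combination huv
    refine ⟨k, ?_, ?_, fun h => ?_⟩
    · rintro rfl
      have h1 : (1 : ℤ) ≤ Nat.card H := by exact_mod_cast hpos
      push_cast at hk
      nlinarith [abs_nonneg u, neg_abs_le u]
    · rw [← Nat.isCoprime_iff_coprime]
      refine ⟨b, (v - (1 + |u|) * b) * A.card, ?_⟩
      rw [← hcard] at hkb
      push_cast at hkb
      linear_combination hkb
    · have h0 : (Nat.card H : ℤ) • h = 0 := by
        rw [natCast_zsmul]; exact card_nsmul_eq_zero'
      rw [smul_smul, show (k : ℤ) * b = 1 - (v - (1 + |u|) * b) * Nat.card H by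
        linear_combination hkb, sub_smul, one_smul, mul_smul, h0, smul_zero, sub_zero]
  -- Translating by the base point `a₀` moves `A` into `H`, where the sizes make the sum with `b •
  -- A'` a factorization of the whole group.
  let t : {x // x ∈ A} → H := fun x => ⟨x - a₀, hAH x x.2 a₀ ha₀⟩
  have ht : Function.Injective t := fun x y hxy => by
    have := congrArg Subtype.val hxy
    exact Subtype.ext (sub_left_injective this)
  let A' : Finset H := A.attach.image t
  let B' : Finset H := A'.image fun h => b • h
  have hbinj : Function.Injective fun h : H => b • h := fun x y hxy => by
    have := congrArg (fun z : H => (k : ℤ) • z) hxy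
    simp only [hk] at this
    exact this
  have hA'card : A'.card = A.card := by
    rw [Finset.card_image_of_injective _ ht, Finset.card_attach]
  have hB'card : B'.card = A.card := by
    rw [Finset.card_image_of_injective _ hbinj, hA'card]
  have hinj' : Set.InjOn (fun x : H × H => x.1 + 1 • x.2) (A' ×ˢ B' : Finset (H × H)) := by
    rintro ⟨x, y⟩ hxy ⟨x', y'⟩ hxy' h
    simp only [A', B', Finset.coe_product, Set.mem_prod, Finset.mem_coe, Finset.mem_image,
      Finset.mem_attach, true_and, one_smul] at hxy hxy' h
    obtain ⟨⟨a, rfl⟩, z, ⟨c, rfl⟩, rfl⟩ := hxy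
    obtain ⟨⟨a', rfl⟩, z, ⟨c', rfl⟩, rfl⟩ := hxy'
    have h2 := congrArg Subtype.val h
    simp only [t, AddSubgroup.coe_add, AddSubgroup.coe_zsmul, smul_sub] at h2
    have h3 : a.1 + b • c.1 = a'.1 + b • c'.1 := by
      have := congrArg (fun z => z + a₀ + b • a₀) h2
      convert this using 1 <;> abel
    have h4 := @hinj (a.1, c.1) (by simp) (a'.1, c'.1) (by simp) h3
    simp only [Prod.mk.injEq] at h4
    rw [Subtype.ext h4.1, Subtype.ext h4.2]
  have hfin := injOn_add_nsmul_of_coprime (A := A') (B := B')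
    (by rw [hA'card, hB'card, hcard, Nat.card_eq_fintype_card]) k 1 hk0
    (by rwa [hB'card]) hinj'
  have m0 : t ⟨a₀, ha₀⟩ ∈ A' := Finset.mem_image_of_mem _ (Finset.mem_attach _ _)
  have m1 : t ⟨a₁, ha₁⟩ ∈ A' := Finset.mem_image_of_mem _ (Finset.mem_attach _ _)
  -- Multiplying the second factor by `k` cancels `b`, so `a₀ + a₁` and `a₁ + a₀` are two
  -- representations of one element.
  have hcomm := @hfin (t ⟨a₀, ha₀⟩, b • t ⟨a₁, ha₁⟩)
    (by simpa using ⟨m0, Finset.mem_image_of_mem _ m1⟩) (t ⟨a₁, ha₁⟩, b • t ⟨a₀, ha₀⟩)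
    (by simpa using ⟨m1, Finset.mem_image_of_mem _ m0⟩) (by
      simp only [one_mul, ← natCast_zsmul, hk, add_comm])
  simp only [Prod.mk.injEq] at hcomm
  exact hne (congrArg Subtype.val (ht hcomm.1))

/-! ### Functions on `ℤ/Nℤ` with small spectrum -/

theorem AddChar.IsPrimitive.injective_zmod {N : ℕ} [NeZero N] {F : Type*} [CommRing F]
    {ψ : AddChar (ZMod N) F} (hψ : ψ.IsPrimitive) : Function.Injective ψ := by
  intro x y hxy
  by_contra hne
  refine hψ (sub_ne_zero.2 hne) ?_
  have h1 : ψ (x - y) = 1 := by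
    rw [sub_eq_add_neg, AddChar.map_add_eq_mul, hxy, ← AddChar.map_add_eq_mul, add_neg_cancel,
      AddChar.map_zero_eq_one]
  ext z
  rw [AddChar.mulShift_apply, ← ZMod.natCast_zmod_val z, mul_comm, ← nsmul_eq_mul,
    AddChar.map_nsmul_eq_pow, h1, one_pow, AddChar.one_apply]

/-- Fourier inversion by orthogonality of characters, with the factor `N` kept so that nothing need
be inverted. -/
theorem sum_sum_mul_addChar_neg {N : ℕ} [NeZero N] {F : Type*} [Field F]
    {ψ : AddChar (ZMod N) F} (hψ : ψ.IsPrimitive) (w : ZMod N → F) (g : ZMod N) :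
    ∑ t, (∑ h, w h * ψ (h * t)) * ψ (-(t * g)) = N * w g := by
  have h1 : ∀ t, (∑ h, w h * ψ (h * t)) * ψ (-(t * g)) = ∑ h, w h * ψ (t * (h - g)) := by
    intro t
    rw [Finset.sum_mul]
    refine Finset.sum_congr rfl fun h _ => ?_
    rw [mul_assoc, ← AddChar.map_add_eq_mul]
    congr 2; ring
  simp only [h1]
  rw [Finset.sum_comm]
  simp only [← Finset.mul_sum, AddChar.sum_mulShift _ hψ, sub_eq_zero, ZMod.card]
  rw [Finset.sum_eq_single g]
  · simp [mul_comm]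
  · intro h _ hg; simp [hg]
  · simp

/-- Among any `#S` consecutive values of a nonzero function with spectrum in `S`, there is a
nonzero one. -/
theorem exists_lt_card_ne_zero {N : ℕ} [NeZero N] {F : Type*} [Field F]
    {ψ : AddChar (ZMod N) F} (hψ : ψ.IsPrimitive) (w : ZMod N → F) (S : Finset (ZMod N))
    (hS : ∀ t ∉ S, ∑ g, w g * ψ (g * t) = 0) {s : ZMod N} (hs : ∑ g, w g * ψ (g * s) ≠ 0)
    (i : ZMod N) : ∃ j < S.card, w (i + (j : ℕ)) ≠ 0 := by
  classical
  by_contra! h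
  have hsS : s ∈ S := by_contra fun hn => hs (hS s hn)
  set W : ZMod N → F := fun t => ∑ g, w g * ψ (g * t) with hW
  -- Inversion expresses the value at `i + j` as a sum over `S` only, with `j` entering as the
  -- exponent of `ψ (-t)`.
  have hsum : ∀ j < S.card, ∑ t ∈ S, W t * ψ (-(t * i)) * ψ (-t) ^ j = 0 := by
    intro j hj
    have h2 := sum_sum_mul_addChar_neg hψ w (i + (j : ℕ))
    rw [h j hj, mul_zero, ← Finset.sum_subset (Finset.subset_univ S)
      (fun t _ ht => by rw [hS t ht, zero_mul])] at h2
    rw [← h2]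
    refine Finset.sum_congr rfl fun t _ => ?_
    rw [mul_assoc, ← AddChar.map_nsmul_eq_pow, ← AddChar.map_add_eq_mul, nsmul_eq_mul]
    congr 2; ring
  -- The relations for `j < |S|` combine into one for any polynomial of degree below `|S|`. This one
  -- has degree `|S| - 1` and isolates the term at `s`, in place of a Vandermonde determinant.
  set P : F[X] := ∏ t ∈ S.erase s, (X - C (ψ (-t))) with hP
  have hdeg : P.natDegree < S.card := by
    rw [hP, natDegree_prod_of_monic _ _ fun t _ => monic_X_sub_C _]
    simp only [natDegree_X_sub_C, Finset.sum_const, smul_eq_mul, mul_one,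
      Finset.card_erase_of_mem hsS]
    have := Finset.card_pos.2 ⟨s, hsS⟩
    omega
  have hzero : ∑ t ∈ S, W t * ψ (-(t * i)) * P.eval (ψ (-t)) = 0 := by
    simp only [eval_eq_sum_range' hdeg, Finset.mul_sum]
    rw [Finset.sum_comm]
    refine Finset.sum_eq_zero fun j hj => ?_
    rw [← mul_zero (P.coeff j), ← hsum j (Finset.mem_range.1 hj), Finset.mul_sum]
    exact Finset.sum_congr rfl fun t _ => by ring
  rw [Finset.sum_eq_single s] at hzero
  · rcases mul_eq_zero.1 hzero with h0 | h0
    · rcases mul_eq_zero.1 h0 with h1 | h1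
      · exact hs h1
      · have h2 := AddChar.map_add_eq_mul ψ (-(s * i)) (s * i)
        rw [h1, zero_mul, neg_add_cancel, AddChar.map_zero_eq_one] at h2
        exact one_ne_zero h2
    · rw [hP, eval_prod, Finset.prod_eq_zero_iff] at h0
      obtain ⟨t, ht, h1⟩ := h0
      rw [eval_sub, eval_X, eval_C, sub_eq_zero] at h1
      exact (Finset.mem_erase.1 ht).1 (neg_injective (hψ.injective_zmod h1)).symm
  · intro t ht hts
    rw [hP, eval_prod, Finset.prod_eq_zero (Finset.mem_erase.2 ⟨hts, ht⟩) (by simp), mul_zero]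
  · exact fun hn => absurd hsS hn

/-- Double counting: for each fixed offset `j`, translation is a bijection, so it contributes `|W|`.
-/
theorem sum_card_filter_range_add_mem {N : ℕ} [NeZero N] (W : Finset (ZMod N)) (k : ℕ) :
    ∑ i : ZMod N, ((Finset.range k).filter fun j : ℕ => i + (j : ZMod N) ∈ W).card =
      k * W.card := by
  simp only [Finset.card_filter]
  rw [Finset.sum_comm]
  have h : ∀ j ∈ Finset.range k,
      (∑ i : ZMod N, if i + (j : ZMod N) ∈ W then 1 else 0) = W.card := by
    intro j _
    refine (Equiv.sum_comp (Equiv.addRight (j : ZMod N)) fun i => if i ∈ W then 1 else 0).trans ?_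
    simp
  rw [Finset.sum_congr rfl h]
  simp

theorem le_mul_card_of_forall_window {N : ℕ} [NeZero N] {W : Finset (ZMod N)} {k : ℕ}
    (h : ∀ i : ZMod N, ∃ j < k, i + ((j : ℕ) : ZMod N) ∈ W) : N ≤ k * W.card := by
  rw [← sum_card_filter_range_add_mem]
  calc N = ∑ i : ZMod N, 1 := by simp [ZMod.card]
    _ ≤ _ := Finset.sum_le_sum fun i _ => by
      obtain ⟨j, hj, hW⟩ := h i
      exact Finset.card_pos.2 ⟨j, Finset.mem_filter.2 ⟨Finset.mem_range.2 hj, hW⟩⟩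

/-- A set that meets each window of length `k`, and is as small as possible, has period `k`. -/
theorem add_mem_of_forall_window {N : ℕ} [NeZero N] {W : Finset (ZMod N)} {k : ℕ}
    (h : ∀ i : ZMod N, ∃ j < k, i + ((j : ℕ) : ZMod N) ∈ W) (hN : N = k * W.card) {i : ZMod N}
    (hi : i ∈ W) : i + (k : ZMod N) ∈ W := by
  -- Each window count is at least one and the counts add up to `k |W| = N`, so each is exactly one.
  have hone : ∀ i : ZMod N,
      ((Finset.range k).filter fun j : ℕ => i + (j : ZMod N) ∈ W).card = 1 := by
    have hle : ∀ i ∈ (Finset.univ : Finset (ZMod N)), 1 ≤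
        ((Finset.range k).filter fun j : ℕ => i + (j : ZMod N) ∈ W).card := fun i _ => by
      obtain ⟨j, hj, hW⟩ := h i
      exact Finset.card_pos.2 ⟨j, Finset.mem_filter.2 ⟨Finset.mem_range.2 hj, hW⟩⟩
    have := (Finset.sum_eq_sum_iff_of_le hle).1 (by
      rw [sum_card_filter_range_add_mem, ← hN]; simp [ZMod.card])
    exact fun i => (this i (Finset.mem_univ i)).symm
  have h0 := hone i
  have h1 := hone (i + 1)
  rw [Finset.card_filter] at h0 h1
  -- Slide the window from `i` to `i + 1`: the element `i` leaves and the count stays one, so `i +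
  -- k` must enter.
  have e := Finset.sum_range_succ (fun j : ℕ => if i + (j : ZMod N) ∈ W then 1 else 0) k
  rw [Finset.sum_range_succ'] at e
  simp only [Nat.cast_zero, add_zero, hi, if_true, h0] at e
  have e2 : (∑ j ∈ Finset.range k, if i + ((j + 1 : ℕ) : ZMod N) ∈ W then 1 else 0) = 1 := by
    refine Eq.trans ?_ h1
    refine Finset.sum_congr rfl fun j _ => ?_
    rw [show i + 1 + (j : ZMod N) = i + ((j + 1 : ℕ) : ZMod N) by push_cast; ring]
  rw [e2] at e
  by_contra hn
  rw [if_neg hn] at e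
  omega

/-- Frobenius in characteristic two. It relates the spectrum at points of one cyclotomic coset, and
so at `s` and `b s` for `s ∈ X`. -/
theorem sum_addChar_mul_two_pow {N : ℕ} [NeZero N] {F : Type*} [Field F] [CharP F 2]
    (ψ : AddChar (ZMod N) F) (A : Finset (ZMod N)) (t : ZMod N) (j : ℕ) :
    ∑ a ∈ A, ψ (a * (t * 2 ^ j)) = (∑ a ∈ A, ψ (a * t)) ^ 2 ^ j := by
  rw [sum_pow_char_pow 2]
  refine Finset.sum_congr rfl fun a _ => ?_
  rw [← AddChar.map_nsmul_eq_pow, nsmul_eq_mul]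
  congr 1
  push_cast
  ring

/-- The square root bound for splittings, in a strict form. -/
theorem IsSplitting.lt_card {N : ℕ} [NeZero N] {F : Type*} [Field F] [CharP F 2]
    {ψ : AddChar (ZMod N) F} (hψ : ψ.IsPrimitive) {b : ℤ} {X S₁ S₂ : Set (ZMod N)}
    (hS : IsSplitting N b X S₁ S₂) {m : ℕ} (hm : 1 < m) (hN : m ^ 2 * X.ncard ≤ N)
    {A : Finset (ZMod N)} (h₁ : ∀ t ∈ S₁, ∑ a ∈ A, ψ (a * t) = 0)
    (h₀ : ∃ s ∈ X, ∑ a ∈ A, ψ (a * s) ≠ 0) : m < A.card := by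
  classical
  by_contra! hA
  obtain ⟨s, hsX, hs⟩ := h₀
  set S : Finset (ZMod N) := X.toFinite.toFinset with hSdef
  have hk : X.ncard = S.card := Set.ncard_eq_toFinset_card X
  rw [hk] at hN
  have hkpos : 0 < S.card := Finset.card_pos.2 ⟨s, by simpa [hSdef] using hsX⟩
  -- `w` is the coefficient sequence of `c(x) c(x^b)`, for `c` the indicator of `A`; its support
  -- lies in `A + b A`, though terms may cancel in `F`.
  let φ : ZMod N × ZMod N → ZMod N := fun x => x.1 + b • x.2
  let w : ZMod N → F := fun g => ∑ x ∈ A ×ˢ A, if φ x = g then 1 else 0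
  have hw : ∀ t, ∑ g, w g * ψ (g * t) = (∑ a ∈ A, ψ (a * t)) * ∑ a ∈ A, ψ (a * (b * t)) := by
    intro t
    simp only [w, Finset.sum_mul, ite_mul, one_mul, zero_mul]
    rw [Finset.sum_comm]
    simp only [Finset.sum_ite_eq, Finset.mem_univ, if_true]
    rw [Finset.sum_product]
    refine Finset.sum_congr rfl fun a _ => ?_
    rw [Finset.mul_sum]
    refine Finset.sum_congr rfl fun a' _ => ?_
    rw [← AddChar.map_add_eq_mul]
    congr 1
    simp only [φ, zsmul_eq_mul]
    ring
  -- On `S₁` the first factor vanishes; on `S₂` the second does, as `b` maps `S₂` to `S₁`.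
  have hwS : ∀ t ∉ S, ∑ g, w g * ψ (g * t) = 0 := by
    intro t ht
    rw [hw]
    have htX : t ∉ X := by simpa [hSdef] using ht
    have htu : t ∈ X ∪ S₁ ∪ S₂ := by rw [hS.cover]; trivial
    rcases htu with (htu | htu) | htu
    · exact absurd htu htX
    · rw [h₁ t htu, zero_mul]
    · rw [h₁ (b * t) (hS.map_two ▸ ⟨t, htu, rfl⟩), mul_zero]
  have hws : ∑ g, w g * ψ (g * s) ≠ 0 := by
    have hmem : (b : ZMod N) * s ∈ cyclotomicCoset N s := by
      rw [← hS.map_X s hsX]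
      exact ⟨s, ⟨0, by simp⟩, rfl⟩
    obtain ⟨j, hj⟩ := hmem
    rw [hw, hj, sum_addChar_mul_two_pow]
    exact mul_ne_zero hs (pow_ne_zero _ hs)
  set W : Finset (ZMod N) := Finset.univ.filter fun g => w g ≠ 0 with hWdef
  have hwin : ∀ i : ZMod N, ∃ j < S.card, i + ((j : ℕ) : ZMod N) ∈ W := by
    intro i
    obtain ⟨j, hj, h⟩ := exists_lt_card_ne_zero hψ w S hwS hws i
    exact ⟨j, hj, by simpa [hWdef] using h⟩
  have hWsub : W ⊆ (A ×ˢ A).image φ := by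
    intro g hg
    by_contra hn
    refine (Finset.mem_filter.1 hg).2 (Finset.sum_eq_zero fun x hx => if_neg fun hx' => hn ?_)
    exact Finset.mem_image.2 ⟨x, hx, hx'⟩
  have hcard1 : W.card ≤ ((A ×ˢ A).image φ).card := Finset.card_le_card hWsub
  have hcard2 : ((A ×ˢ A).image φ).card ≤ A.card * A.card := by
    rw [← Finset.card_product]; exact Finset.card_image_le
  have hcard3 : A.card * A.card ≤ m ^ 2 := by rw [sq]; exact Nat.mul_le_mul hA hA
  have hNW := le_mul_card_of_forall_window hwin
  have hWm : m ^ 2 ≤ W.card := by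
    refine Nat.le_of_mul_le_mul_left (?_ : S.card * m ^ 2 ≤ _) hkpos
    rw [mul_comm]; exact hN.trans hNW
  -- The chain `N ≤ |X| |W| ≤ |X| |A|² ≤ |X| m² ≤ N` collapses to equalities.
  have hWcard : W.card = m ^ 2 := by omega
  have hAA : A.card * A.card = m ^ 2 := by omega
  have hAm : A.card = m := by nlinarith
  have hNeq : N = S.card * W.card := by
    refine le_antisymm hNW ?_
    rw [hWcard, mul_comm]; exact hN
  have himage : (A ×ˢ A).image φ = W := (Finset.eq_of_subset_of_card_le hWsub (by omega)).symm
  have hinj : Set.InjOn φ (A ×ˢ A : Finset (ZMod N × ZMod N)) := by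
    apply Finset.card_image_iff.1
    rw [himage, Finset.card_product]
    omega
  let H : AddSubgroup (ZMod N) := AddSubgroup.zmultiples (S.card : ZMod N)
  have hH : Nat.card H = m ^ 2 := by
    rw [Nat.card_zmultiples, ZMod.addOrderOf_coe _ (NeZero.ne N),
      Nat.gcd_eq_right (Dvd.intro _ hNeq.symm), ← hWcard]
    exact Nat.div_eq_of_eq_mul_right hkpos hNeq
  obtain ⟨w₀, hw₀⟩ : W.Nonempty := Finset.card_pos.1 (by rw [hWcard]; positivity)
  have hmult : ∀ j : ℕ, w₀ + j • (S.card : ZMod N) ∈ W := by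
    intro j
    induction j with
    | zero => simpa using hw₀
    | succ j ih =>
      rw [succ_nsmul, ← add_assoc]
      exact add_mem_of_forall_window hwin hNeq ih
  -- Periodicity puts the coset `w₀ + H` inside `W`, and both have `m ^ 2` elements.
  have hcoset : ∀ x ∈ W, x - w₀ ∈ H := by
    have hsub : (Finset.univ.filter fun x : ZMod N => x - w₀ ∈ H) ⊆ W := by
      intro x hx
      obtain ⟨j, hj⟩ := (mem_zmultiples_iff_mem_range_addOrderOf).1 (Finset.mem_filter.1 hx).2
        |> Finset.mem_image.1
      have := hmult j
      rwa [hj.2, add_sub_cancel] at this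
    have hc : (Finset.univ.filter fun x : ZMod N => x - w₀ ∈ H).card = m ^ 2 := by
      rw [← hH, Nat.card_eq_fintype_card, Fintype.card_subtype]
      exact Finset.card_equiv (Equiv.subRight w₀) (by simp)
    have := Finset.eq_of_subset_of_card_le hsub (by omega)
    intro x hx
    rw [← this] at hx
    exact (Finset.mem_filter.1 hx).2
  -- The elements `x + b x` and `y + b x` of `W` differ by `x - y`.
  have hAH : ∀ x ∈ A, ∀ y ∈ A, x - y ∈ H := by
    intro x hx y hy
    have h1 := hcoset (φ (x, x)) (himage ▸ Finset.mem_image_of_mem _ (by simp [hx]))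
    have h2 := hcoset (φ (y, x)) (himage ▸ Finset.mem_image_of_mem _ (by simp [hx, hy]))
    have := H.sub_mem h1 h2
    convert this using 1
    simp only [φ]
    abel
  refine not_injOn_add_zsmul H (by rw [hH, hAA]) (by omega) hAH ?_ hinj
  have hco : IsCoprime (N : ℤ) b := Int.isCoprime_iff_gcd_eq_one.2 hS.coprime
  refine hco.symm.of_isCoprime_of_dvd_right ?_
  rw [hH, hNeq, hWcard]
  exact ⟨S.card, by push_cast; ring⟩

/-! ### Cyclic codes with a prescribed spectrum -/

theorem IsUnionOfCosets.union {n : ℕ} {A B : Set (ZMod n)} (hA : IsUnionOfCosets A)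
    (hB : IsUnionOfCosets B) : IsUnionOfCosets (A ∪ B) := by
  rintro s (hs | hs)
  · exact (hA s hs).trans Set.subset_union_left
  · exact (hB s hs).trans Set.subset_union_right

theorem vecPoly_add {n : ℕ} (c d : Fin n → ZMod 2) : vecPoly (c + d) = vecPoly c + vecPoly d := by
  simp [vecPoly, add_mul, Finset.sum_add_distrib]

theorem vecPoly_smul {n : ℕ} (a : ZMod 2) (c : Fin n → ZMod 2) : vecPoly (a • c) = a • vecPoly c := by
  simp [vecPoly, smul_eq_C_mul, Finset.mul_sum, mul_assoc]

section CyclicCodes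

variable {n : ℕ} [NeZero n] {F : Type*} [Field F] [Algebra (ZMod 2) F]

theorem val_finEquiv (i : Fin n) : (ZMod.finEquiv n i).val = i := by
  obtain ⟨m, rfl⟩ := Nat.exists_eq_succ_of_ne_zero (NeZero.ne n)
  rfl

theorem finEquiv_eq_natCast (i : Fin n) : ZMod.finEquiv n i = ((i : ℕ) : ZMod n) := by
  rw [← val_finEquiv i, ZMod.natCast_zmod_val]

/-- The value at `ψ t` of the polynomial of a vector. -/
noncomputable def codeEval (ψ : AddChar (ZMod n) F) (t : ZMod n) :
    (Fin n → ZMod 2) →ₗ[ZMod 2] F where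
  toFun c := ∑ x : ZMod n, algebraMap (ZMod 2) F (c ((ZMod.finEquiv n).symm x)) * ψ (x * t)
  map_add' c d := by simp [add_mul, Finset.sum_add_distrib]
  map_smul' a c := by simp [Algebra.smul_def, Finset.mul_sum, mul_assoc]

theorem codeEval_apply (ψ : AddChar (ZMod n) F) (t : ZMod n) (c : Fin n → ZMod 2) :
    codeEval ψ t c =
      ∑ x : ZMod n, algebraMap (ZMod 2) F (c ((ZMod.finEquiv n).symm x)) * ψ (x * t) := rfl

theorem aeval_vecPoly (ψ : AddChar (ZMod n) F) (t : ZMod n) (c : Fin n → ZMod 2) :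
    aeval (ψ t) (vecPoly c) = codeEval ψ t c := by
  rw [codeEval_apply, vecPoly, map_sum, ← Equiv.sum_comp (ZMod.finEquiv n).toEquiv]
  refine Finset.sum_congr rfl fun i _ => ?_
  rw [map_mul, aeval_C, map_pow, aeval_X]
  simp only [RingEquiv.toEquiv_eq_coe, EquivLike.coe_coe, RingEquiv.symm_apply_apply]
  rw [finEquiv_eq_natCast, ← nsmul_eq_mul, AddChar.map_nsmul_eq_pow]

/-- The support of a vector, as a subset of `ℤ/nℤ`. -/
def zmodSupport (c : Fin n → ZMod 2) : Finset (ZMod n) :=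
  Finset.univ.filter fun x => c ((ZMod.finEquiv n).symm x) ≠ 0

theorem card_zmodSupport (c : Fin n → ZMod 2) :
    (zmodSupport c).card = (Finset.univ.filter fun i => c i ≠ 0).card :=
  Finset.card_equiv (ZMod.finEquiv n).symm.toEquiv fun x => by simp [zmodSupport]

theorem codeEval_eq_sum_zmodSupport (ψ : AddChar (ZMod n) F) (t : ZMod n) (c : Fin n → ZMod 2) :
    codeEval ψ t c = ∑ a ∈ zmodSupport c, ψ (a * t) := by
  rw [codeEval_apply, zmodSupport, Finset.sum_filter]
  refine Finset.sum_congr rfl fun x _ => ?_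
  generalize c ((ZMod.finEquiv n).symm x) = a
  rcases (show a = 0 ∨ a = 1 by revert a; decide) with rfl | rfl <;> simp

/-- The vectors whose polynomial vanishes at `ψ t` for all `t ∈ A`. -/
noncomputable def spectralCode (ψ : AddChar (ZMod n) F) (A : Set (ZMod n)) : BinaryCode n :=
  ⨅ t ∈ A, LinearMap.ker (codeEval ψ t)

theorem mem_spectralCode {ψ : AddChar (ZMod n) F} {A : Set (ZMod n)} {c : Fin n → ZMod 2} :
    c ∈ spectralCode ψ A ↔ ∀ t ∈ A, codeEval ψ t c = 0 := by
  simp [spectralCode, Submodule.mem_iInf]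

theorem spectralCode_anti (ψ : AddChar (ZMod n) F) {A B : Set (ZMod n)} (h : A ⊆ B) :
    spectralCode ψ B ≤ spectralCode ψ A := fun _ hc =>
  mem_spectralCode.2 fun t ht => mem_spectralCode.1 hc t (h ht)

/-- The cyclic shift by `s` positions. -/
def shiftBy (s : ZMod n) (c : Fin n → ZMod 2) : Fin n → ZMod 2 :=
  fun i => c ((ZMod.finEquiv n).symm (ZMod.finEquiv n i - s))

theorem codeEval_shiftBy (ψ : AddChar (ZMod n) F) (t s : ZMod n) (c : Fin n → ZMod 2) :
    codeEval ψ t (shiftBy s c) = ψ (s * t) * codeEval ψ t c := by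
  rw [codeEval_apply, codeEval_apply, Finset.mul_sum, ← Equiv.sum_comp (Equiv.addRight s)]
  refine Finset.sum_congr rfl fun x _ => ?_
  simp only [shiftBy, Equiv.coe_addRight, RingEquiv.apply_symm_apply, add_sub_cancel_right]
  rw [add_mul, AddChar.map_add_eq_mul]
  ring

theorem shiftBy_mem_spectralCode {ψ : AddChar (ZMod n) F} {A : Set (ZMod n)}
    {c : Fin n → ZMod 2} (hc : c ∈ spectralCode ψ A) (s : ZMod n) :
    shiftBy s c ∈ spectralCode ψ A := by
  rw [mem_spectralCode] at hc ⊢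
  intro t ht
  rw [codeEval_shiftBy, hc t ht, mul_zero]

theorem cyclicShift_eq_shiftBy (c : Fin n → ZMod 2) : cyclicShift c = shiftBy 1 c := by
  funext i
  simp only [cyclicShift, shiftBy]
  congr 1
  rw [Equiv.symm_apply_eq, finRotate_apply, eq_comm]
  apply (ZMod.finEquiv n).injective
  rw [map_add, RingEquiv.apply_symm_apply, map_one, sub_add_cancel]

theorem isCyclicCode_spectralCode (ψ : AddChar (ZMod n) F) (A : Set (ZMod n)) :
    IsCyclicCode (spectralCode ψ A) := fun c hc => by
  rw [cyclicShift_eq_shiftBy]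
  exact shiftBy_mem_spectralCode hc 1

/-- The polynomial with roots `ψ t`, `t ∈ A`, is defined over `𝔽₂`: doubling permutes `A`, so
squaring permutes the roots and Frobenius fixes each coefficient. The roots are distinct, so
divisibility is vanishing on `A`. -/
theorem exists_generator {ψ : AddChar (ZMod n) F} (hψ : ψ.IsPrimitive) {A : Set (ZMod n)}
    (hA : IsUnionOfCosets A) :
    ∃ g : (ZMod 2)[X], g.Monic ∧ g.natDegree = A.ncard ∧
      (∀ p, g ∣ p ↔ ∀ t ∈ A, aeval (ψ t) p = 0) ∧ ∀ t, aeval (ψ t) g = 0 ↔ t ∈ A := by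
  classical
  have hchar : CharP F 2 := charP_of_injective_algebraMap (algebraMap (ZMod 2) F).injective 2
  have hinj := hψ.injective_zmod
  set S : Finset (ZMod n) := A.toFinite.toFinset with hS
  have hmemS : ∀ t, t ∈ S ↔ t ∈ A := fun t => by simp [hS]
  set G : F[X] := ∏ t ∈ S, (X - C (ψ t)) with hG
  have hGmonic : G.Monic := monic_prod_of_monic _ _ fun t _ => monic_X_sub_C _
  have hsq : ∀ t, ψ (t * 2) = ψ t ^ 2 := fun t => by
    rw [mul_two, AddChar.map_add_eq_mul, sq]
  have hdbl : Function.Injective fun t : ZMod n => t * 2 := fun x y hxy => by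
    have := congrArg ψ hxy
    simp only [hsq] at this
    exact hinj (frobenius_inj F 2 this)
  have himage : S.image (fun t => t * 2) = S := by
    refine Finset.eq_of_subset_of_card_le (fun x hx => ?_)
      (Finset.card_image_of_injective S hdbl).ge
    obtain ⟨t, ht, rfl⟩ := Finset.mem_image.1 hx
    exact (hmemS _).2 (hA t ((hmemS t).1 ht) ⟨1, by rw [pow_one]⟩)
  have hfrob : G.map (frobenius F 2) = G := by
    conv_rhs => rw [hG, ← himage, Finset.prod_image hdbl.injOn]
    rw [hG, Polynomial.map_prod]
    refine Finset.prod_congr rfl fun t _ => ?_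
    rw [Polynomial.map_sub, map_X, map_C, frobenius_def, hsq]
  have hlifts : G ∈ Polynomial.lifts (algebraMap (ZMod 2) F) := by
    rw [Polynomial.lifts_iff_coeff_lifts]
    intro k
    have h := congrArg (fun p => p.coeff k) hfrob
    simp only [coeff_map, frobenius_def] at h
    rcases mul_eq_zero.1 (show G.coeff k * (G.coeff k - 1) = 0 by linear_combination h) with h | h
    · exact ⟨0, by rw [h, map_zero]⟩
    · exact ⟨1, by rw [map_one, sub_eq_zero.1 h]⟩
  obtain ⟨g, hgG, hdeg, hmonic⟩ := Polynomial.lifts_and_natDegree_eq_and_monic hlifts hGmonic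
  refine ⟨g, hmonic, ?_, fun p => ?_, fun t => ?_⟩
  · rw [hdeg, hG, natDegree_prod_of_monic _ _ fun t _ => monic_X_sub_C _]
    simp only [natDegree_X_sub_C, Finset.sum_const, smul_eq_mul, mul_one]
    rw [Set.ncard_eq_toFinset_card A]
  · rw [← Polynomial.map_dvd_map' (algebraMap (ZMod 2) F), hgG]
    have hroot : ∀ t, X - C (ψ t) ∣ p.map (algebraMap (ZMod 2) F) ↔ aeval (ψ t) p = 0 :=
      fun t => by rw [dvd_iff_isRoot, IsRoot.def, aeval_def, eval₂_eq_eval_map]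
    simp only [← hroot]
    constructor
    · exact fun h t ht => (Finset.dvd_prod_of_mem (fun t => X - C (ψ t)) ((hmemS t).2 ht)).trans h
    · intro h
      exact Finset.prod_dvd_of_coprime (s := fun t => X - C (ψ t))
        ((pairwise_coprime_X_sub_C hinj).set_pairwise _) fun t ht => h t ((hmemS t).1 ht)
  · rw [aeval_def, eval₂_eq_eval_map, hgG, hG, eval_prod, Finset.prod_eq_zero_iff]
    simp only [eval_sub, eval_X, eval_C, sub_eq_zero, hmemS]
    exact ⟨fun ⟨s, hs, h⟩ => hinj h ▸ hs, fun h => ⟨t, h, rfl⟩⟩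

theorem dvd_vecPoly_iff {ψ : AddChar (ZMod n) F} {A : Set (ZMod n)} {g : (ZMod 2)[X]}
    (hg : ∀ p, g ∣ p ↔ ∀ t ∈ A, aeval (ψ t) p = 0) (c : Fin n → ZMod 2) :
    g ∣ vecPoly c ↔ c ∈ spectralCode ψ A := by
  simp only [hg, mem_spectralCode, aeval_vecPoly]

theorem isCyclicWithDefiningSet_spectralCode {α : F} (hα : IsPrimitiveRoot α n)
    {A : Set (ZMod n)} (hA : IsUnionOfCosets A) :
    IsCyclicWithDefiningSet α (spectralCode (AddChar.zmodChar n hα.pow_eq_one) A) A := by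
  obtain ⟨g, hmonic, -, hdvd, hzero⟩ :=
    exists_generator (AddChar.zmodChar_primitive_of_primitive_root n hα) hA
  refine ⟨isCyclicCode_spectralCode _ _, g, ⟨hmonic, ?_, fun c => ?_⟩, ?_⟩
  · rw [hdvd]
    intro t _
    rw [map_sub, map_pow, aeval_X, map_one, ← AddChar.map_nsmul_eq_pow, nsmul_eq_mul,
      ZMod.natCast_self, zero_mul, AddChar.map_zero_eq_one, sub_self]
  · exact (dvd_vecPoly_iff hdvd c).symm
  · ext t
    exact (hzero t).symm

theorem exists_vecPoly_eq {q : (ZMod 2)[X]} (hq : q.degree < n) :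
    ∃ c : Fin n → ZMod 2, vecPoly c = q := by
  refine ⟨fun i => q.coeff i, ?_⟩
  have hdeg : q.natDegree < n := by
    by_cases h : q = 0
    · rw [h, natDegree_zero]; exact Nat.pos_of_ne_zero (NeZero.ne n)
    · exact (natDegree_lt_iff_degree_lt h).2 hq
  conv_rhs => rw [q.as_sum_range_C_mul_X_pow' hdeg]
  exact Fin.sum_univ_eq_sum_range (fun i => C (q.coeff i) * X ^ i) n

/-- The code is the kernel of reduction to `𝔽₂[x] / (g)`, a space of dimension `deg g = |A|`;
reduction is onto because remainders have degree below `deg g ≤ n`. -/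
theorem finrank_spectralCode_add_ncard {ψ : AddChar (ZMod n) F} (hψ : ψ.IsPrimitive)
    {A : Set (ZMod n)} (hA : IsUnionOfCosets A) :
    Module.finrank (ZMod 2) (spectralCode ψ A) + A.ncard = n := by
  obtain ⟨g, hmonic, hdeg, hdvd, -⟩ := exists_generator hψ hA
  let f : (Fin n → ZMod 2) →ₗ[ZMod 2] AdjoinRoot g :=
    { toFun := fun c => AdjoinRoot.mk g (vecPoly c)
      map_add' := fun c d => by rw [vecPoly_add, map_add]
      map_smul' := fun a c => by rw [vecPoly_smul, AdjoinRoot.smul_mk, RingHom.id_apply] }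
  have hker : LinearMap.ker f = spectralCode ψ A := by
    ext c
    rw [LinearMap.mem_ker, ← dvd_vecPoly_iff hdvd]
    exact AdjoinRoot.mk_eq_zero
  have hdegn : g.natDegree ≤ n := by
    rw [hdeg]
    simpa using Set.ncard_le_card A
  have hrange : LinearMap.range f = ⊤ := by
    rw [LinearMap.range_eq_top]
    intro y
    obtain ⟨p, rfl⟩ := AdjoinRoot.mk_surjective y
    obtain ⟨c, hc⟩ := exists_vecPoly_eq (n := n) (q := p %ₘ g)
      ((degree_modByMonic_lt p hmonic).trans_le
        (degree_le_natDegree.trans (by exact_mod_cast hdegn)))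
    refine ⟨c, ?_⟩
    change AdjoinRoot.mk g (vecPoly c) = _
    rw [hc, AdjoinRoot.mk_eq_mk]
    exact ⟨-(p /ₘ g), by linear_combination modByMonic_add_div p g⟩
  have hrank : Module.finrank (ZMod 2) (AdjoinRoot g) = A.ncard := by
    rw [(AdjoinRoot.powerBasis' hmonic).finrank, AdjoinRoot.powerBasis'_dim, hdeg]
  have h := LinearMap.finrank_range_add_finrank_ker f
  rw [hrange, finrank_top, hker, hrank, Module.finrank_fin_fun] at h
  omega

/-- The generator polynomial itself is a codeword, since its degree `|A|` is below `n`, and it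
vanishes only on `A`. -/
theorem exists_mem_spectralCode_codeEval_ne_zero {ψ : AddChar (ZMod n) F} (hψ : ψ.IsPrimitive)
    {A : Set (ZMod n)} (hA : IsUnionOfCosets A) {t : ZMod n} (ht : t ∉ A) :
    ∃ c ∈ spectralCode ψ A, codeEval ψ t c ≠ 0 := by
  obtain ⟨g, hmonic, hdeg, hdvd, hzero⟩ := exists_generator hψ hA
  have hlt : A.ncard < n := by
    have hne : A ≠ Set.univ := fun h => ht (by rw [h]; trivial)
    simpa [Set.ncard_univ] using
      Set.ncard_lt_ncard (Set.ssubset_univ_iff.2 hne) (Set.toFinite Set.univ)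
  obtain ⟨c, hc⟩ := exists_vecPoly_eq (n := n) (q := g)
    (degree_le_natDegree.trans_lt (by rw [hdeg]; exact_mod_cast hlt))
  refine ⟨c, (dvd_vecPoly_iff hdvd c).1 (by rw [hc]), ?_⟩
  rw [← aeval_vecPoly, hc, Ne, hzero]
  exact ht

theorem algebraMap_dotProduct (v c : Fin n → ZMod 2) :
    algebraMap (ZMod 2) F (v ⬝ᵥ c) = ∑ x : ZMod n,
      algebraMap (ZMod 2) F (v ((ZMod.finEquiv n).symm x)) *
        algebraMap (ZMod 2) F (c ((ZMod.finEquiv n).symm x)) := by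
  rw [dotProduct, map_sum, ← Equiv.sum_comp (ZMod.finEquiv n).symm.toEquiv]
  simp

/-- Orthogonality to all shifts of a codeword `c` kills the correlation of `v` with `c`, whose
Fourier coefficient is the product of those of `v` at `-t` and `c` at `t`. Choose `c` with the
latter nonzero. -/
theorem codeEval_neg_eq_zero_of_mem_dualCode {ψ : AddChar (ZMod n) F} (hψ : ψ.IsPrimitive)
    {A : Set (ZMod n)} (hA : IsUnionOfCosets A) {v : Fin n → ZMod 2}
    (hv : v ∈ dualCode (spectralCode ψ A)) {t : ZMod n} (ht : t ∉ A) :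
    codeEval ψ (-t) v = 0 := by
  obtain ⟨c, hc, hct⟩ := exists_mem_spectralCode_codeEval_ne_zero hψ hA ht
  have hzero : ∑ s : ZMod n, ψ (-(s * t)) * algebraMap (ZMod 2) F (v ⬝ᵥ shiftBy s c) = 0 :=
    Finset.sum_eq_zero fun s _ => by
      rw [hv _ (shiftBy_mem_spectralCode hc s), map_zero, mul_zero]
  have hprod : codeEval ψ (-t) v * codeEval ψ t c = 0 := by
    rw [← hzero, codeEval_apply, Finset.sum_mul]
    simp only [algebraMap_dotProduct, Finset.mul_sum]
    rw [Finset.sum_comm]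
    refine Finset.sum_congr rfl fun x _ => ?_
    rw [codeEval_apply, Finset.mul_sum, ← Equiv.sum_comp (Equiv.subLeft x)]
    refine Finset.sum_congr rfl fun s _ => ?_
    simp only [shiftBy, Equiv.subLeft_apply, RingEquiv.apply_symm_apply]
    have h : ψ (-(s * t)) = ψ (x * -t) * ψ ((x - s) * t) := by
      rw [← AddChar.map_add_eq_mul]
      congr 1; ring
    rw [h]; ring
  exact (mul_eq_zero.1 hprod).resolve_right hct

/-- Parseval: the products of these coefficients sum to `n` times the inner product. -/
theorem exists_codeEval_ne_zero_of_dotProduct_ne_zero {ψ : AddChar (ZMod n) F}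
    (hψ : ψ.IsPrimitive) (hn : (n : F) ≠ 0) {v c : Fin n → ZMod 2} (h : v ⬝ᵥ c ≠ 0) :
    ∃ t, codeEval ψ (-t) v ≠ 0 ∧ codeEval ψ t c ≠ 0 := by
  by_contra! hcon
  have hsum : ∑ t, codeEval ψ (-t) v * codeEval ψ t c = 0 :=
    Finset.sum_eq_zero fun t _ => by
      by_cases hv : codeEval ψ (-t) v = 0
      · rw [hv, zero_mul]
      · rw [hcon t hv, mul_zero]
  have heq : ∑ t, codeEval ψ (-t) v * codeEval ψ t c =
      n * algebraMap (ZMod 2) F (v ⬝ᵥ c) := by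
    rw [algebraMap_dotProduct, Finset.mul_sum]
    conv_lhs => enter [2, t]; rw [codeEval_apply ψ (-t) v, Finset.sum_mul]
    rw [Finset.sum_comm]
    refine Finset.sum_congr rfl fun x _ => ?_
    rw [mul_left_comm, ← sum_sum_mul_addChar_neg hψ
      (fun y => algebraMap (ZMod 2) F (c ((ZMod.finEquiv n).symm y))), Finset.mul_sum]
    refine Finset.sum_congr rfl fun t _ => ?_
    rw [codeEval_apply, show x * -t = -(t * x) by ring]
    ring
  rw [heq] at hsum
  rcases mul_eq_zero.1 hsum with h0 | h0
  · exact hn h0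
  · exact h ((map_eq_zero _).1 h0)

section SplittingBound

variable {ψ : AddChar (ZMod n) F} {b : ℤ} {X S₁ S₂ : Set (ZMod n)} {m : ℕ}

theorem IsSplitting.lt_weight (hψ : ψ.IsPrimitive) (hS : IsSplitting n b X S₁ S₂)
    (hm : 1 < m) (hN : m ^ 2 * X.ncard ≤ n) {u : Fin n → ZMod 2} (hu : u ∈ spectralCode ψ S₁)
    (hu' : u ∉ spectralCode ψ (X ∪ S₁)) : m < (Finset.univ.filter fun i => u i ≠ 0).card := by
  have hchar : CharP F 2 := charP_of_injective_algebraMap (algebraMap (ZMod 2) F).injective 2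
  rw [← card_zmodSupport]
  rw [mem_spectralCode] at hu hu'
  refine hS.lt_card hψ hm hN (fun t ht => ?_) ?_
  · rw [← codeEval_eq_sum_zmodSupport, hu t ht]
  · push Not at hu'
    obtain ⟨t, ht, hne⟩ := hu'
    refine ⟨t, ht.resolve_right fun h => hne (hu t h), ?_⟩
    rwa [← codeEval_eq_sum_zmodSupport]

/-- Negating positions turns the `-t` of duality into `t`. The negated word then has zeros on `S₂`
and a nonzero coefficient on `X`, so the bound for the splitting with `S₁`, `S₂` exchanged applies.
-/
theorem IsSplitting.lt_weight_dual (hψ : ψ.IsPrimitive) (hn : (n : F) ≠ 0)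
    (hS : IsSplitting n b X S₁ S₂) (hm : 1 < m) (hN : m ^ 2 * X.ncard ≤ n)
    {v : Fin n → ZMod 2} (hv : v ∈ dualCode (spectralCode ψ (X ∪ S₁)))
    (hv' : v ∉ dualCode (spectralCode ψ S₁)) :
    m < (Finset.univ.filter fun i => v i ≠ 0).card := by
  classical
  have hchar : CharP F 2 := charP_of_injective_algebraMap (algebraMap (ZMod 2) F).injective 2
  have hsum : ∀ t, ∑ a ∈ (zmodSupport v).image Neg.neg, ψ (a * t) = codeEval ψ (-t) v := by
    intro t
    rw [codeEval_eq_sum_zmodSupport, Finset.sum_image neg_injective.injOn]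
    simp only [neg_mul, mul_neg]
  have hvS₂ : ∀ t ∈ S₂, codeEval ψ (-t) v = 0 := fun t ht =>
    codeEval_neg_eq_zero_of_mem_dualCode hψ (hS.cosets_X.union hS.cosets_one) hv fun h =>
      h.elim (fun h => Set.disjoint_left.1 hS.disjoint_X_two h ht)
        fun h => Set.disjoint_left.1 hS.disjoint_one_two h ht
  obtain ⟨c, hc, hvc⟩ : ∃ c ∈ spectralCode ψ S₁, v ⬝ᵥ c ≠ 0 := by
    by_contra! h
    exact hv' h
  obtain ⟨t, hvt, hct⟩ := exists_codeEval_ne_zero_of_dotProduct_ne_zero hψ hn hvc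
  rw [← card_zmodSupport, ← Finset.card_image_of_injective _ neg_injective]
  refine hS.symm.lt_card hψ hm hN (fun t ht => by rw [hsum, hvS₂ t ht]) ⟨t, ?_, ?_⟩
  · have htu : t ∈ X ∪ S₁ ∪ S₂ := by rw [hS.cover]; trivial
    rcases htu with (h | h) | h
    · exact h
    · exact absurd (mem_spectralCode.1 hc t h) hct
    · exact absurd (hvS₂ t h) hvt
  · rwa [hsum]

end SplittingBound

end CyclicCodes

/-! ### The CSS construction -/

/-- The sign `(-1) ^ a`. -/
noncomputable def binarySign (a : ZMod 2) : ℂ := if a = 0 then 1 else -1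

theorem zmod_two_cases (a : ZMod 2) : a = 0 ∨ a = 1 := by
  revert a; decide

@[simp] theorem binarySign_zero : binarySign 0 = 1 := if_pos rfl

@[simp] theorem binarySign_one : binarySign 1 = -1 := if_neg one_ne_zero

theorem binarySign_add (a b : ZMod 2) : binarySign (a + b) = binarySign a * binarySign b := by
  rcases zmod_two_cases a with rfl | rfl <;> rcases zmod_two_cases b with rfl | rfl <;>
    simp [show (1 : ZMod 2) + 1 = 0 from rfl]

theorem binarySign_sum {ι : Type*} (s : Finset ι) (f : ι → ZMod 2) :
    binarySign (∑ i ∈ s, f i) = ∏ i ∈ s, binarySign (f i) := by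
  classical
  induction s using Finset.induction_on with
  | empty => simp
  | insert a s ha ih => rw [Finset.sum_insert ha, Finset.prod_insert ha, binarySign_add, ih]

theorem sigmaX_pow_mul_sigmaZ_pow_apply (a b x y : Fin 2) :
    (sigmaX ^ (a : ℕ) * sigmaZ ^ (b : ℕ)) x y =
      if y = x + a then (if b * y = 0 then 1 else -1) else 0 := by
  fin_cases a <;> fin_cases b <;> fin_cases x <;> fin_cases y <;>
  simp [sigmaX, sigmaZ]

section CSS

variable {n : ℕ}

theorem add_self_zmod_two (x : Fin n → ZMod 2) : x + x = 0 := by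
  funext i
  exact CharTwo.add_self_eq_zero (x i)

/-- The amplitudes of a state, indexed by the vectors over `ZMod 2`. -/
def amp (ψ : (Fin n → Fin 2) → ℂ) : (Fin n → ZMod 2) → ℂ := ψ

/-- The state with the given amplitudes. -/
def ofAmp (f : (Fin n → ZMod 2) → ℂ) : (Fin n → Fin 2) → ℂ := f

theorem amp_ext {ψ φ : (Fin n → Fin 2) → ℂ} (h : ∀ x, amp ψ x = amp φ x) : ψ = φ := funext h

theorem amp_smul (a : ℂ) (ψ : (Fin n → Fin 2) → ℂ) (x : Fin n → ZMod 2) :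
    amp (a • ψ) x = a * amp ψ x := rfl

theorem star_dotProduct_eq_sum_amp (ψ φ : (Fin n → Fin 2) → ℂ) :
    star ψ ⬝ᵥ φ = ∑ x : Fin n → ZMod 2, star (amp ψ x) * amp φ x := rfl

theorem amp_pauli_mulVec (u v : Fin n → ZMod 2) (φ : (Fin n → Fin 2) → ℂ) (x : Fin n → ZMod 2) :
    amp (pauli u v *ᵥ φ) x = binarySign (v ⬝ᵥ (x + u)) * amp φ (x + u) := by
  have hsum : amp (pauli u v *ᵥ φ) x = ∑ y : Fin n → ZMod 2,
      (∏ i, if y i = x i + u i then binarySign (v i * y i) else 0) * amp φ y :=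
    Finset.sum_congr rfl fun y _ => congrArg (· * amp φ y)
      (Finset.prod_congr rfl fun i _ => sigmaX_pow_mul_sigmaZ_pow_apply (u i) (v i) (x i) (y i))
  rw [hsum, Finset.sum_eq_single (x + u)]
  · congr 1
    rw [dotProduct, binarySign_sum]
    exact Finset.prod_congr rfl fun i _ => if_pos rfl
  · intro y _ hy
    obtain ⟨i, hi⟩ := Function.ne_iff.1 hy
    rw [Finset.prod_eq_zero (Finset.mem_univ i) (if_neg hi), zero_mul]
  · exact fun h => absurd (Finset.mem_univ _) h

theorem qubitMatrix_ext {M N : QubitMatrix n} (h : ∀ φ x, amp (M *ᵥ φ) x = amp (N *ᵥ φ) x) :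
    M = N :=
  Matrix.mulVec_injective (funext fun φ => amp_ext (h φ))

theorem pauli_zero : pauli (0 : Fin n → ZMod 2) 0 = 1 := by
  refine qubitMatrix_ext fun φ x => ?_
  rw [amp_pauli_mulVec, zero_dotProduct, binarySign_zero, one_mul, add_zero, one_mulVec]

theorem pauli_mul (u v u' v' : Fin n → ZMod 2) :
    pauli u v * pauli u' v' = binarySign (v ⬝ᵥ u') • pauli (u + u') (v + v') := by
  refine qubitMatrix_ext fun φ x => ?_
  have hdot : v ⬝ᵥ (x + u) = v ⬝ᵥ u' + v ⬝ᵥ (x + (u + u')) := by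
    rw [← dotProduct_add]
    congr 1
    rw [show u' + (x + (u + u')) = x + u + (u' + u') by abel, add_self_zmod_two, add_zero]
  rw [← mulVec_mulVec, smul_mulVec, amp_smul, amp_pauli_mulVec, amp_pauli_mulVec,
    amp_pauli_mulVec, hdot, binarySign_add, add_dotProduct, binarySign_add, add_assoc]
  ring

theorem commute_pauli {u v u' v' : Fin n → ZMod 2} (h : v ⬝ᵥ u' = v' ⬝ᵥ u) :
    Commute (pauli u v) (pauli u' v') := by
  rw [Commute, SemiconjBy, pauli_mul, pauli_mul, h, add_comm u, add_comm v]

theorem exists_unit_eq_pauli {u v : Fin n → ZMod 2} (h : v ⬝ᵥ u = 0) :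
    ∃ g : (QubitMatrix n)ˣ, (g : QubitMatrix n) = pauli u v := by
  have : pauli u v * pauli u v = 1 := by
    rw [pauli_mul, h, binarySign_zero, one_smul, add_self_zmod_two, add_self_zmod_two, pauli_zero]
  exact ⟨⟨_, _, this, this⟩, rfl⟩

theorem commute_of_mem_closure {M : Type*} [Monoid M] {S : Set Mˣ} {a : M}
    (h : ∀ g ∈ S, Commute a (g : M)) {g : Mˣ} (hg : g ∈ Subgroup.closure S) :
    Commute a (g : M) := by
  induction hg using Subgroup.closure_induction with
  | mem g hg => exact h g hg
  | one => exact Commute.one_right a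
  | mul g g' _ _ hg hg' => exact hg.mul_right hg'
  | inv g _ hg => exact hg.units_inv_right

theorem exists_mem_dualCode_dotProduct_ne_zero {D : BinaryCode n} {x : Fin n → ZMod 2}
    (hx : x ∉ D) : ∃ v ∈ dualCode D, v ⬝ᵥ x ≠ 0 := by
  classical
  obtain ⟨f, hfx, hfD⟩ := Submodule.exists_le_ker_of_notMem hx
  have hf : ∀ y, (fun i => f (Pi.single i 1)) ⬝ᵥ y = f y := fun y => by
    rw [f.pi_apply_eq_sum_univ y, dotProduct]
    refine Finset.sum_congr rfl fun i _ => ?_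
    rw [smul_eq_mul, mul_comm]
    congr 2
    funext j
    simp [Pi.single_apply, eq_comm]
  exact ⟨_, fun c hc => (hf c).trans (hfD hc), by rwa [hf]⟩

/-- The generators `X^u` impose invariance under `C`. The generators `Z^v` multiply the amplitude at
`x` by a sign, which forces it to vanish unless `x` lies in the double dual `D`. -/
theorem mem_stabilizerCode_cssGroup {C D : BinaryCode n} {ψ : (Fin n → Fin 2) → ℂ} :
    ψ ∈ stabilizerCode (cssGroup C D) ↔
      (∀ u ∈ C, ∀ x, amp ψ (x + u) = amp ψ x) ∧ ∀ x ∉ D, amp ψ x = 0 := by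
  constructor
  · intro h
    refine ⟨fun u hu x => ?_, fun x hx => ?_⟩
    · obtain ⟨g, hg⟩ := exists_unit_eq_pauli (zero_dotProduct u)
      have h1 := h g (Subgroup.subset_closure (Or.inl ⟨u, hu, hg⟩))
      rw [hg] at h1
      have h2 := amp_pauli_mulVec u 0 ψ x
      rw [h1, zero_dotProduct, binarySign_zero, one_mul] at h2
      exact h2.symm
    · obtain ⟨v, hv, hvx⟩ := exists_mem_dualCode_dotProduct_ne_zero hx
      obtain ⟨g, hg⟩ := exists_unit_eq_pauli (dotProduct_zero v)
      have h1 := h g (Subgroup.subset_closure (Or.inr ⟨v, hv, hg⟩))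
      rw [hg] at h1
      have h2 := amp_pauli_mulVec 0 v ψ x
      rw [h1, add_zero, (zmod_two_cases _).resolve_left hvx, binarySign_one] at h2
      linear_combination (1 / 2 : ℂ) * h2
  · rintro ⟨hC, hD⟩ g hg
    induction hg using Subgroup.closure_induction with
    | mem g hg =>
      rcases hg with ⟨u, hu, hg⟩ | ⟨v, hv, hg⟩
      · rw [hg]
        refine amp_ext fun x => ?_
        rw [amp_pauli_mulVec, zero_dotProduct, binarySign_zero, one_mul, hC u hu x]
      · rw [hg]
        refine amp_ext fun x => ?_
        rw [amp_pauli_mulVec, add_zero]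
        by_cases hx : x ∈ D
        · rw [hv x hx, binarySign_zero, one_mul]
        · rw [hD x hx, mul_zero]
    | one => exact one_mulVec ψ
    | mul g g' _ _ hg hg' =>
      rw [Units.val_mul, ← mulVec_mulVec, hg', hg]
    | inv g _ hg =>
      conv_lhs => rw [← hg]
      rw [mulVec_mulVec, Units.inv_mul, one_mulVec]

theorem commute_pauli_of_mem_cssGroup {C D : BinaryCode n} {u v : Fin n → ZMod 2}
    (hu : u ∈ D) (hv : v ∈ dualCode C) {g : (QubitMatrix n)ˣ} (hg : g ∈ cssGroup C D) :
    Commute (pauli u v) (g : QubitMatrix n) := by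
  refine commute_of_mem_closure ?_ hg
  rintro g (⟨u', hu', hg⟩ | ⟨v', hv', hg⟩)
  · rw [hg]
    exact commute_pauli (by rw [hv u' hu', zero_dotProduct])
  · rw [hg]
    exact commute_pauli (by rw [hv' u hu, dotProduct_zero])

theorem dualCode_anti {C D : BinaryCode n} (h : C ≤ D) : dualCode D ≤ dualCode C :=
  fun _ hv c hc => hv c (h hc)

open Classical in
/-- The uniform superposition of the basis states in a coset of `C`. -/
noncomputable def cosetState (C : BinaryCode n) (w : Fin n → ZMod 2) : (Fin n → Fin 2) → ℂ :=
  ofAmp fun x => if x + w ∈ C then 1 else 0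

open Classical in
theorem amp_cosetState (C : BinaryCode n) (w x : Fin n → ZMod 2) :
    amp (cosetState C w) x = if x + w ∈ C then 1 else 0 := rfl

theorem cosetState_mem {C D : BinaryCode n} (h : C ≤ D) {w : Fin n → ZMod 2} (hw : w ∈ D) :
    cosetState C w ∈ stabilizerCode (cssGroup C D) := by
  classical
  rw [mem_stabilizerCode_cssGroup]
  refine ⟨fun u hu x => ?_, fun x hx => if_neg fun hxC => hx ?_⟩
  · rw [amp_cosetState, amp_cosetState, add_right_comm]
    exact if_congr (Submodule.add_mem_iff_left C hu) rfl rfl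
  · have := D.add_mem (h hxC) hw
    rwa [add_assoc, add_self_zmod_two, add_zero] at this

theorem isStabilizerGroup_cssGroup {C D : BinaryCode n} (h : C ≤ D) :
    IsStabilizerGroup (cssGroup C D) := by
  refine ⟨Subgroup.closure_mono ?_, fun g hg g' hg' => ?_, fun g hg a ha => ?_⟩
  · rintro g (⟨u, -, hg⟩ | ⟨v, -, hg⟩)
    · exact ⟨0, u, 0, by rw [hg, pow_zero, one_smul]⟩
    · exact ⟨0, 0, v, by rw [hg, pow_zero, one_smul]⟩
  · refine Units.ext ?_
    rw [Units.val_mul, Units.val_mul]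
    refine commute_of_mem_closure (fun g' hg' => (Commute.symm ?_)) hg'
    rcases hg' with ⟨u, hu, hg'⟩ | ⟨v, hv, hg'⟩
    · rw [hg']
      exact commute_pauli_of_mem_cssGroup (h hu) (dualCode C).zero_mem hg
    · rw [hg']
      exact commute_pauli_of_mem_cssGroup D.zero_mem (dualCode_anti h hv) hg
  -- A scalar in the group fixes a state whose amplitude at `0` is `1`, so the scalar is `1`.
  · have h1 := cosetState_mem h D.zero_mem g hg
    rw [ha, smul_mulVec, one_mulVec] at h1
    have h2 := amp_smul a (cosetState C 0) 0
    rw [h1, amp_cosetState, add_zero, if_pos C.zero_mem, mul_one] at h2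
    refine Units.ext ?_
    rw [ha, ← h2, one_smul, Units.val_one]

/-- Functions supported on `D` and invariant under `C` are the functions on `D / C`. -/
theorem finrank_stabilizerCode_cssGroup {C D : BinaryCode n} (h : C ≤ D) {k : ℕ}
    (hk : Module.finrank (ZMod 2) C + k = Module.finrank (ZMod 2) D) :
    Module.finrank ℂ (stabilizerCode (cssGroup C D)) = 2 ^ k := by
  classical
  let C' : Submodule (ZMod 2) D := C.comap D.subtype
  let Φ : ((D ⧸ C') → ℂ) →ₗ[ℂ] ((Fin n → Fin 2) → ℂ) :=
    { toFun := fun f => ofAmp fun x => if hx : x ∈ D then f (C'.mkQ ⟨x, hx⟩) else 0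
      map_add' := fun f g => by
        refine amp_ext fun x => ?_
        change (if hx : x ∈ D then (f + g) (C'.mkQ ⟨x, hx⟩) else 0) =
          (if hx : x ∈ D then f (C'.mkQ ⟨x, hx⟩) else 0) +
          (if hx : x ∈ D then g (C'.mkQ ⟨x, hx⟩) else 0)
        by_cases hx : x ∈ D <;> simp [hx]
      map_smul' := fun a f => by
        refine amp_ext fun x => ?_
        change (if hx : x ∈ D then (a • f) (C'.mkQ ⟨x, hx⟩) else 0) =
          a * (if hx : x ∈ D then f (C'.mkQ ⟨x, hx⟩) else 0)
        by_cases hx : x ∈ D <;> simp [hx] }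
  have hΦ : ∀ f (x : D), amp (Φ f) x.1 = f (C'.mkQ x) := fun f x => dif_pos x.2
  have hΦ0 : ∀ f x, x ∉ D → amp (Φ f) x = 0 := fun f x hx => dif_neg hx
  have hinj : Function.Injective Φ := fun f g hfg => by
    funext q
    obtain ⟨x, rfl⟩ := C'.mkQ_surjective q
    rw [← hΦ f, ← hΦ g, hfg]
  have hrange : LinearMap.range Φ = stabilizerCode (cssGroup C D) := by
    ext ψ
    rw [mem_stabilizerCode_cssGroup, LinearMap.mem_range]
    constructor
    · rintro ⟨f, rfl⟩
      refine ⟨fun u hu x => ?_, hΦ0 f⟩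
      by_cases hx : x ∈ D
      · rw [hΦ f ⟨x, hx⟩]
        refine (hΦ f ⟨x + u, D.add_mem hx (h hu)⟩).trans ?_
        congr 1
        rw [Submodule.mkQ_apply, Submodule.mkQ_apply, Submodule.Quotient.eq]
        simpa [C'] using hu
      · rw [hΦ0 f x hx, hΦ0 f]
        exact fun hxu => hx ((Submodule.add_mem_iff_left D (h hu)).1 hxu)
    · rintro ⟨hC, hD⟩
      refine ⟨fun q => amp ψ (Function.surjInv C'.mkQ_surjective q).1, amp_ext fun x => ?_⟩
      by_cases hx : x ∈ D
      · refine (hΦ _ ⟨x, hx⟩).trans ?_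
        have hq := Function.surjInv_eq C'.mkQ_surjective (C'.mkQ ⟨x, hx⟩)
        set y := Function.surjInv C'.mkQ_surjective (C'.mkQ ⟨x, hx⟩)
        rw [Submodule.mkQ_apply, Submodule.mkQ_apply, Submodule.Quotient.eq] at hq
        have := hC _ hq x
        rw [← this]
        congr 1
        exact (add_sub_cancel x y.1).symm
      · rw [hΦ0 _ x hx, hD x hx]
  have hfin : Module.finrank (ZMod 2) C' = Module.finrank (ZMod 2) C :=
    (Submodule.comapSubtypeEquivOfLe h).finrank_eq
  have hquot : Module.finrank (ZMod 2) (D ⧸ C') = k := by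
    have := C'.finrank_quotient_add_finrank
    omega
  have : Fintype (D ⧸ C') := Fintype.ofFinite _
  rw [← hrange, LinearMap.finrank_range_of_inj hinj, Module.finrank_fintype_fun_eq_card,
    Module.card_eq_pow_finrank (K := ZMod 2), hquot, ZMod.card]

/-- If `u ∉ D`, the error moves the support off `D`; if `v` is not orthogonal to some `c ∈ C`, the
terms at `x` and `x + c` cancel. Both are detected with scalar `0`. An error with `u ∈ C` and `v ∈
D^⊥` acts as the identity, with scalar `1`. -/
theorem mem_sdiff_of_not_isDetectable {C D : BinaryCode n} {u v : Fin n → ZMod 2}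
    (h : ¬ IsDetectable (stabilizerCode (cssGroup C D)) u v) :
    (u ∈ D ∧ u ∉ C) ∨ (v ∈ dualCode C ∧ v ∉ dualCode D) := by
  have huD : u ∈ D := by
    by_contra hu
    refine h ⟨0, fun ψ hψ φ hφ => ?_⟩
    rw [mem_stabilizerCode_cssGroup] at hψ hφ
    rw [star_dotProduct_eq_sum_amp, zero_mul]
    refine Finset.sum_eq_zero fun x _ => ?_
    by_cases hx : x ∈ D
    · rw [amp_pauli_mulVec, hφ.2 (x + u) fun hxu => hu ((Submodule.add_mem_iff_right D hx).1 hxu),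
        mul_zero, mul_zero]
    · rw [hψ.2 x hx, star_zero, zero_mul]
  have hvC : v ∈ dualCode C := by
    intro c hc
    by_contra hvc
    refine h ⟨0, fun ψ hψ φ hφ => ?_⟩
    rw [mem_stabilizerCode_cssGroup] at hψ hφ
    rw [star_dotProduct_eq_sum_amp, zero_mul]
    have hneg : ∀ x, star (amp ψ (x + c)) * amp (pauli u v *ᵥ φ) (x + c) =
        -(star (amp ψ x) * amp (pauli u v *ᵥ φ) x) := fun x => by
      rw [amp_pauli_mulVec, amp_pauli_mulVec, hψ.1 c hc, add_right_comm, hφ.1 c hc,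
        dotProduct_add v (x + u), binarySign_add, (zmod_two_cases _).resolve_left hvc,
        binarySign_one]
      ring
    have hsum := Equiv.sum_comp (Equiv.addRight c) fun x : Fin n → ZMod 2 =>
      star (amp ψ x) * amp (pauli u v *ᵥ φ) x
    simp only [Equiv.coe_addRight, hneg, Finset.sum_neg_distrib] at hsum
    linear_combination (-1 / 2 : ℂ) * hsum
  by_contra! hcon
  refine h ⟨1, fun ψ hψ φ hφ => ?_⟩
  rw [mem_stabilizerCode_cssGroup] at hψ hφ
  rw [star_dotProduct_eq_sum_amp, star_dotProduct_eq_sum_amp, one_mul]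
  refine Finset.sum_congr rfl fun x _ => ?_
  by_cases hx : x ∈ D
  · rw [amp_pauli_mulVec, hcon.2 hvC _ (D.add_mem hx huD), binarySign_zero, one_mul,
      hφ.1 u (hcon.1 huD)]
  · rw [hψ.2 x hx, star_zero, zero_mul, zero_mul]

/-- The error exchanges the orthogonal coset states of `C` and `u + C`: the first forces the scalar
to be `0`, while its overlap with the second is a nonzero norm. -/
theorem not_isDetectable_of_mem_sdiff {C D : BinaryCode n} (h : C ≤ D) {u : Fin n → ZMod 2}
    (hu : u ∈ D) (huC : u ∉ C) : ¬ IsDetectable (stabilizerCode (cssGroup C D)) u 0 := by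
  classical
  rintro ⟨a, ha⟩
  have hpauli : ∀ w, pauli u 0 *ᵥ cosetState C w = cosetState C (w + u) := fun w => by
    refine amp_ext fun x => ?_
    rw [amp_pauli_mulVec, zero_dotProduct, binarySign_zero, one_mul, amp_cosetState,
      amp_cosetState, add_assoc, add_comm u]
  have hself : star (cosetState C 0) ⬝ᵥ cosetState C 0 ≠ 0 := by
    have hcard : star (cosetState C 0) ⬝ᵥ cosetState C 0 =
        ((Finset.univ.filter fun x => x ∈ C).card : ℂ) := by
      rw [star_dotProduct_eq_sum_amp, Finset.card_filter, Nat.cast_sum]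
      refine Finset.sum_congr rfl fun x _ => ?_
      rw [amp_cosetState, add_zero]
      split_ifs <;> simp
    rw [hcard, Nat.cast_ne_zero, Finset.card_ne_zero]
    exact ⟨0, by simp⟩
  have horth : star (cosetState C 0) ⬝ᵥ cosetState C u = 0 := by
    rw [star_dotProduct_eq_sum_amp]
    refine Finset.sum_eq_zero fun x _ => ?_
    rw [amp_cosetState, amp_cosetState, add_zero]
    by_cases hx : x ∈ C
    · rw [if_neg fun hxu => huC ((Submodule.add_mem_iff_right C hx).1 hxu), mul_zero]
    · rw [if_neg hx, star_zero, zero_mul]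
  have h0 := cosetState_mem h D.zero_mem
  have h1 := ha _ h0 _ h0
  rw [hpauli, zero_add, horth] at h1
  have ha0 : a = 0 := (mul_eq_zero.1 h1.symm).resolve_right hself
  have h2 := ha _ h0 _ (cosetState_mem h hu)
  rw [hpauli, add_self_zmod_two, ha0, zero_mul] at h2
  exact hself h2

theorem exists_hasMinDistance_cssGroup {C D : BinaryCode n} (h : C < D) {m : ℕ}
    (hX : ∀ u ∈ D, u ∉ C → m < (Finset.univ.filter fun i => u i ≠ 0).card)
    (hZ : ∀ v ∈ dualCode C, v ∉ dualCode D → m < (Finset.univ.filter fun i => v i ≠ 0).card) :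
    ∃ d, m < d ∧ HasMinDistance (stabilizerCode (cssGroup C D)) d := by
  obtain ⟨u, huD, huC⟩ := SetLike.exists_of_lt h
  have hne : {w | ∃ u v : Fin n → ZMod 2,
      ¬ IsDetectable (stabilizerCode (cssGroup C D)) u v ∧ pauliWeight u v = w}.Nonempty :=
    ⟨_, u, 0, not_isDetectable_of_mem_sdiff h.le huD huC, rfl⟩
  refine ⟨sInf _, ?_, Nat.sInf_mem hne, fun w hw => Nat.sInf_le hw⟩
  obtain ⟨u, v, hd, hw⟩ := Nat.sInf_mem hne
  rw [← hw]
  rcases mem_sdiff_of_not_isDetectable hd with ⟨h1, h2⟩ | ⟨h1, h2⟩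
  · refine (hX u h1 h2).trans_le (Finset.card_le_card fun i hi => ?_)
    simp only [Finset.mem_filter, Finset.mem_univ, true_and] at hi ⊢
    exact Or.inl hi
  · refine (hZ v h1 h2).trans_le (Finset.card_le_card fun i hi => ?_)
    simp only [Finset.mem_filter, Finset.mem_univ, true_and] at hi ⊢
    exact Or.inr hi

end CSS

/-! ### The CSS code of an extended splitting -/

theorem coeff_vecPoly {n : ℕ} (c : Fin n → ZMod 2) (i : Fin n) : (vecPoly c).coeff i = c i := by
  simp only [vecPoly, finsetSum_coeff, coeff_C_mul, coeff_X_pow, mul_ite, mul_one, mul_zero]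
  rw [Finset.sum_eq_single i]
  · simp
  · intro j _ hj
    rw [if_neg]
    exact fun h => hj (Fin.ext h.symm)
  · simp

theorem degree_vecPoly_lt {n : ℕ} (c : Fin n → ZMod 2) : (vecPoly c).degree < n :=
  degree_sum_fin_lt c

/-- Spreading a codeword of length `n₂` over the multiples of `n₁` gives a word of weight at most
`n₂`, whose spectrum is the lift of the spectrum of the codeword. -/
theorem exists_ne_zero_card_le {n₁ n₂ : ℕ} [NeZero n₁] [NeZero n₂] [NeZero (n₁ * n₂)]
    {F : Type*} [Field F] [Algebra (ZMod 2) F] {α : F} (hα : IsPrimitiveRoot α (n₁ * n₂))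
    {A : Set (ZMod n₂)} (hA : IsUnionOfCosets A) (hA' : A ≠ Set.univ) :
    ∃ u ∈ spectralCode (AddChar.zmodChar (n₁ * n₂) hα.pow_eq_one) (reduceHom n₁ n₂ ⁻¹' A),
      u ≠ 0 ∧ (Finset.univ.filter fun i => u i ≠ 0).card ≤ n₂ := by
  have hn₁ : 0 < n₁ := Nat.pos_of_ne_zero (NeZero.ne n₁)
  have hβ : IsPrimitiveRoot (α ^ n₁) n₂ :=
    hα.pow (Nat.pos_of_ne_zero (NeZero.ne (n₁ * n₂))) rfl
  obtain ⟨t₀, ht₀⟩ := (Set.ne_univ_iff_exists_notMem A).1 hA'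
  obtain ⟨e, he, het⟩ := exists_mem_spectralCode_codeEval_ne_zero
    (AddChar.zmodChar_primitive_of_primitive_root n₂ hβ) hA ht₀
  have hdeg : (expand (ZMod 2) n₁ (vecPoly e)).degree < (n₁ * n₂ : ℕ) := by
    by_cases h0 : vecPoly e = 0
    · rw [h0, map_zero, degree_zero]
      exact WithBot.bot_lt_coe _
    · have h1 := (natDegree_lt_iff_degree_lt h0).2 (degree_vecPoly_lt e)
      refine (natDegree_lt_iff_degree_lt ((expand_ne_zero hn₁).2 h0)).1 ?_
      rw [natDegree_expand, mul_comm]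
      exact Nat.mul_lt_mul_of_pos_left h1 hn₁
  obtain ⟨u, hu⟩ := exists_vecPoly_eq hdeg
  refine ⟨u, mem_spectralCode.2 fun t ht => ?_, ?_, ?_⟩
  -- Evaluating `e(x ^ n₁)` at `α ^ t` evaluates `e` at a power of the primitive `n₂`-th root `α ^
  -- n₁`, which depends only on `t` modulo `n₂`.
  · have hchar : AddChar.zmodChar (n₁ * n₂) hα.pow_eq_one t ^ n₁ =
        AddChar.zmodChar n₂ hβ.pow_eq_one (reduceHom n₁ n₂ t) := by
      rw [← ZMod.natCast_zmod_val t, map_natCast (reduceHom n₁ n₂), AddChar.zmodChar_apply',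
        AddChar.zmodChar_apply', pow_right_comm]
    rw [← aeval_vecPoly, hu, expand_aeval, hchar, aeval_vecPoly]
    exact mem_spectralCode.1 he _ ht
  · rintro rfl
    have h0 : vecPoly e = 0 := by
      rw [← expand_eq_zero hn₁, ← hu]
      simp [vecPoly]
    rw [← aeval_vecPoly, h0, map_zero] at het
    exact het rfl
  · have hdvd : ∀ i, u i ≠ 0 → n₁ ∣ (i : ℕ) := fun i hi => by
      by_contra hn
      rw [← coeff_vecPoly u i, hu, coeff_expand hn₁, if_neg hn] at hi
      exact hi rfl
    refine le_of_le_of_eq (b := (Finset.range n₂).card) ?_ (Finset.card_range n₂)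
    refine Finset.card_le_card_of_injOn (fun i => (i : ℕ) / n₁) (fun i hi => ?_) ?_
    · exact Finset.mem_coe.2 (Finset.mem_range.2 (Nat.div_lt_of_lt_mul i.2))
    · intro i hi j hj hij
      have hi := hdvd i (Finset.mem_filter.1 (Finset.mem_coe.1 hi)).2
      have hj := hdvd j (Finset.mem_filter.1 (Finset.mem_coe.1 hj)).2
      exact Fin.ext ((Nat.div_left_inj hi hj).1 hij)

theorem mainTheorem1 (n₁ n₂ : ℕ) (hn₁ : Odd n₁) (hn₂ : Odd n₂)
    (T₀ T₁ T₂ : Set (ZMod n₁)) (U₀ U₁ U₂ : Set (ZMod n₂))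
    (hTU : (∃ b : ℤ, IsSplitting n₁ b T₀ T₁ T₂ ∧ IsSplitting n₂ b U₀ U₁ U₂) ∨
      ((∃ a b : ℤ, IsSplitting n₁ a T₀ T₁ T₂ ∧ IsSplitting n₂ b U₀ U₁ U₂) ∧
        Nat.gcd n₁ n₂ = 1))
    (hU₀ : U₀ = {0})
    (hn : (n₂ : ℝ) ≤ (n₁ : ℝ) / (T₀.ncard : ℝ))
    {F : Type*} [Field F] [Algebra (ZMod 2) F] (α : F) (hα : IsPrimitiveRoot α (n₁ * n₂)) :
    (∃ b : ℤ, IsSplitting (n₁ * n₂) b (extendedZero n₁ n₂ T₀)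
      (extendedPart n₁ n₂ T₁ U₁) (extendedPart n₁ n₂ T₂ U₂)) ∧
    ∃ C D : BinaryCode (n₁ * n₂),
      IsCyclicWithDefiningSet α C (extendedZero n₁ n₂ T₀ ∪ extendedPart n₁ n₂ T₁ U₁) ∧
      IsCyclicWithDefiningSet α D (extendedPart n₁ n₂ T₁ U₁) ∧
      C ≤ D ∧
      IsStabilizerGroup (cssGroup C D) ∧
      (∃ d : ℕ, n₂ < d ∧
        IsQuantumCode (n₁ * n₂) T₀.ncard d (stabilizerCode (cssGroup C D))) ∧
      IsDegenerate (cssGroup C D) := by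
  subst hU₀
  have : NeZero n₁ := ⟨hn₁.pos.ne'⟩
  have : NeZero n₂ := ⟨hn₂.pos.ne'⟩
  have : NeZero (n₁ * n₂) := ⟨(Nat.mul_pos hn₁.pos hn₂.pos).ne'⟩
  obtain ⟨b, hT, hU⟩ : ∃ b : ℤ, IsSplitting n₁ b T₀ T₁ T₂ ∧ IsSplitting n₂ b {0} U₁ U₂ := by
    rcases hTU with h | ⟨⟨a, b, hT, hU⟩, h⟩
    · exact h
    · exact hT.exists_common_multiplier hU h
  have hS := hT.extended hU
  refine ⟨⟨b, hS⟩, ?_⟩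
  set S₀ := extendedZero n₁ n₂ T₀
  set S₁ := extendedPart n₁ n₂ T₁ U₁
  set S₂ := extendedPart n₁ n₂ T₂ U₂
  set ψ := AddChar.zmodChar (n₁ * n₂) hα.pow_eq_one
  have hψ : ψ.IsPrimitive := AddChar.zmodChar_primitive_of_primitive_root (n₁ * n₂) hα
  have hS₀₁ : IsUnionOfCosets (S₀ ∪ S₁) := hS.cosets_X.union hS.cosets_one
  have hm : 1 < n₂ := by
    by_contra! h
    obtain rfl : n₂ = 1 := le_antisymm h hn₂.pos
    obtain ⟨u, hu⟩ := hU.nonempty_one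
    exact Set.disjoint_left.1 hU.disjoint_X_one (Subsingleton.elim u 0) hu
  have hcard : S₀.ncard = T₀.ncard := ncard_extendedZero T₀
  have hTpos : 0 < T₀.ncard := (Set.ncard_pos (Set.toFinite T₀)).2 hT.nonempty_X
  -- The hypothesis says `n₂ |T₀| ≤ n₁`; multiplied by `n₂`, it is the size condition of the square
  -- root bound with `m = n₂`.
  have hN : n₂ ^ 2 * S₀.ncard ≤ n₁ * n₂ := by
    rw [le_div_iff₀ (by exact_mod_cast hTpos)] at hn
    have hn' : n₂ * T₀.ncard ≤ n₁ := by exact_mod_cast hn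
    rw [hcard]
    nlinarith
  have hNF : ((n₁ * n₂ : ℕ) : F) ≠ 0 := (hα.neZero').ne
  have hCD : spectralCode ψ (S₀ ∪ S₁) ≤ spectralCode ψ S₁ :=
    spectralCode_anti ψ Set.subset_union_right
  have hrank : Module.finrank (ZMod 2) (spectralCode ψ (S₀ ∪ S₁)) + T₀.ncard =
      Module.finrank (ZMod 2) (spectralCode ψ S₁) := by
    have h1 := finrank_spectralCode_add_ncard hψ hS₀₁
    have h2 := finrank_spectralCode_add_ncard hψ hS.cosets_one
    rw [Set.ncard_union_eq hS.disjoint_X_one] at h1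
    omega
  have hlt : spectralCode ψ (S₀ ∪ S₁) < spectralCode ψ S₁ :=
    lt_of_le_of_ne hCD fun h => by
      rw [h] at hrank
      omega
  obtain ⟨d, hd, hdist⟩ := exists_hasMinDistance_cssGroup hlt
    (fun u hu hu' => hS.lt_weight hψ hm hN hu hu')
    (fun v hv hv' => hS.lt_weight_dual hψ hNF hm hN hv hv')
  obtain ⟨u, hu, hu0, hwt⟩ := exists_ne_zero_card_le (n₁ := n₁) hα
    (hU.cosets_X.union hU.cosets_one) fun h => by
      obtain ⟨t, ht⟩ := hU.nonempty_two
      rcases (h ▸ Set.mem_univ t : t ∈ {0} ∪ U₁) with h' | h'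
      · exact Set.disjoint_left.1 hU.disjoint_X_two h' ht
      · exact Set.disjoint_left.1 hU.disjoint_one_two h' ht
  -- Scaled elements reduce to `0` and lifted ones into `U₁`, so the zeros of `u` include the
  -- defining set of `C`. Hence `X^u` is a stabilizer of weight at most `n₂`.
  have huC : u ∈ spectralCode ψ (S₀ ∪ S₁) := by
    refine spectralCode_anti ψ ?_ hu
    rintro t (ht | ht)
    · obtain ⟨i, -, rfl⟩ := mem_extendedZero.1 ht
      exact Or.inl (reduceHom_scaleHom _ _ i)
    · rcases mem_extendedPart.1 ht with ⟨i, -, rfl⟩ | ht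
      · exact Or.inl (reduceHom_scaleHom _ _ i)
      · exact Or.inr ht
  refine ⟨spectralCode ψ (S₀ ∪ S₁), spectralCode ψ S₁,
    isCyclicWithDefiningSet_spectralCode hα hS₀₁,
    isCyclicWithDefiningSet_spectralCode hα hS.cosets_one, hCD, isStabilizerGroup_cssGroup hCD,
    ⟨d, hd, finrank_stabilizerCode_cssGroup hCD hrank, hdist⟩,
    d, hdist, u, 0, Or.inl hu0,
    fun g hg => commute_pauli_of_mem_cssGroup (hCD huC) (Submodule.zero_mem _) hg, ?_⟩
  refine lt_of_le_of_lt ?_ hd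
  simpa [pauliWeight] using hwt
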